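/- Let $R$ be a commutative Noetherian ring of positive characteristic, let $(r_{ij})$ be an $m\times n$-matrix with entries in $R$, and let $\mathfrak a\subseteq R$ be the ideal generated by the $\min\{m,n\}$-minors of $(r_{ij})$. Let $\operatorname{ht}(\mathfrak a)$ denote the height of $\mathfrak a$, and let $\operatorname{cd}(R,\mathfrak a)$ denote its cohomological dimension, that is, the least natural number $c$ such that the local cohomology modules $H^i_{\mathfrak a}(M)$ vanish for all $R$-modules $M$ and all $i>c$. If $\operatorname{ht}(\mathfrak a)=|n-m|+1$, then $\operatorname{cd}(R,\mathfrak a)=\operatorname{ht}(\mathfrak a)$. -/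

import Mathlib

universe u

/-- The ideal generated by the `t`-minors of an `m × n` matrix, i.e. by the determinants of all its
`t × t` submatrices (rows and columns chosen in increasing order; the `0`-minor is `1`). -/
def Matrix.minorsIdeal {R : Type u} [CommRing R] {m n : ℕ} (A : Matrix (Fin m) (Fin n) R)
    (t : ℕ) : Ideal R :=
  Ideal.span {x : R | ∃ (f : Fin t ↪o Fin m) (g : Fin t ↪o Fin n), x = (A.submatrix f g).det}

/-- The cohomological dimension `cd(R, a)`: the least natural number `c` such that the local
cohomology modules `H_a^i(M)` vanish for all `R`-modules `M` and all `i > c`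
(and `⊤` if there is no such `c`). -/
noncomputable def Ideal.cohomologicalDimension {R : Type u} [CommRing R] (a : Ideal R) : ℕ∞ :=
  ⨅ (c : ℕ) (_ : ∀ (M : ModuleCat.{u} R) (i : ℕ), c < i →
    CategoryTheory.Limits.IsZero ((localCohomology a i).obj M)), (c : ℕ∞)

/-!
Both bounds use that the local cohomology with support in `a` is the direct limit of the modules
`Ext^i(R/a^t, -)`, in which the powers of `a` may be replaced by any cofinal chain of ideals.

For `cd ≤ |n - m| + 1`, filter a module killed by `q` by modules killed by primes `p` and lift the
matrix to the generic matrix `(X_ij)` over a ring of characteristic `p`. There the Frobenius powers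
of the ideal of maximal minors are cofinal with its powers, and they are the ideals of maximal
minors of the matrices `(X_ij ^ p^e)`. The quotients by these have projective dimension at most
`|n - m| + 1`: such an ideal is the annihilator of the cokernel of its matrix, and the ideals of the
matrices obtained by deleting the first column, or the first row and the first column, are linked to
it by two short exact sequences with isomorphic kernels.

The inequality `ht ≤ cd` holds for every proper ideal of a Noetherian ring. Localizing at a minimal
prime of height at least `ht` replaces the ideal by the maximal ideal `m` of a local ring. If the
local cohomology of finitely generated modules vanishes in degree `c + 1`, then `H = H^c(R)`
satisfies `m H = H` when `c > 0`; as `H` is Artinian, some `x ∈ m` already satisfies `x H = H`.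
Hence the vanishing holds for `R/x` in degree `c`, while passing to `R/x` lowers the dimension by at
most one.
-/

open CategoryTheory Limits Abelian Function

universe v w

noncomputable section

/-! ### Local cohomology as a direct limit of `Ext` -/

section DerivedExt

variable {R : Type u} [CommRing R]

/-- Precomposition with a chain map, as a map of the cochain complexes `Hom(P, M) ⟶ Hom(P', M)`. -/
def linearYonedaObjMap {P P' : ChainComplex (ModuleCat.{u} R) ℕ} (φ : P' ⟶ P)
    (M : ModuleCat.{u} R) : P.linearYonedaObj R M ⟶ P'.linearYonedaObj R M :=
  (HomologicalComplex.unopFunctor _ _).map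
    (((((linearYoneda R (ModuleCat.{u} R)).obj M).rightOp.mapHomologicalComplex _).map φ).op)

theorem isoExt_hom_naturality {X X' : ModuleCat.{u} R} (g : X' ⟶ X) (P : ProjectiveResolution X)
    (P' : ProjectiveResolution X') (φ : ProjectiveResolution.Hom P' P g) (n : ℕ)
    (M : ModuleCat.{u} R) :
    ((Ext R (ModuleCat.{u} R) n).map g.op).app M ≫ (P'.isoExt (R := R) n M).hom =
      (P.isoExt n M).hom ≫ HomologicalComplex.homologyMap (linearYonedaObjMap φ.hom M) n := by
  have hres := congrArg Quiver.Hom.unop <|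
    ProjectiveResolution.isoLeftDerivedObj_inv_naturality g P' P φ.hom
      (by simpa using φ.hom_f_zero_comp_π_f_zero)
      ((linearYoneda R (ModuleCat.{u} R)).obj M).rightOp n
  have hop := congrArg Quiver.Hom.unop <|
    HomologicalComplex.homologyOp_hom_naturality (linearYonedaObjMap φ.hom M) n
  have hop' := (Iso.comp_inv_eq (HomologicalComplex.homologyUnop _ n)).2
    (((Iso.inv_comp_eq (HomologicalComplex.homologyUnop _ n)).2 hop.symm).symm.trans
      (Category.assoc _ _ _).symm)
  exact (Category.assoc _ _ _).symm.trans ((congrArg (· ≫ _) hres).trans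
    ((Category.assoc _ _ _).trans ((congrArg (_ ≫ ·) hop').trans (Category.assoc _ _ _).symm)))

theorem homologyπ_apply_eq_zero_iff (K : CochainComplex (ModuleCat.{u} R) ℕ) (n : ℕ)
    (z : K.cycles (n + 1)) :
    K.homologyπ (n + 1) z = 0 ↔ ∃ y : K.X n, K.d n (n + 1) y = K.iCycles (n + 1) z := by
  have hinj : Injective (K.iCycles (n + 1)) := (ModuleCat.mono_iff_injective _).1 inferInstance
  have hexact := ShortComplex.exact_of_g_is_cokernel
    (ShortComplex.mk _ _ (K.toCycles_comp_homologyπ n (n + 1)))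
    (K.homologyIsCokernel n (n + 1) (by simp))
  refine (((ShortComplex.ShortExact.moduleCat_exact_iff_function_exact _).1 hexact) z).trans ?_
  refine exists_congr fun y ↦ ?_
  rw [← hinj.eq_iff, ← K.toCycles_i n (n + 1)]
  rfl

/-- The class in the derived-functor `Ext` of a cocycle on a projective resolution; the analogue of
`ProjectiveResolution.extMk`, which lands in `Abelian.Ext`. -/
def derivedExtMk {X : ModuleCat.{u} R} (P : ProjectiveResolution X) {n : ℕ} {M : ModuleCat.{u} R}
    (f : P.complex.X n ⟶ M) (hf : P.complex.d (n + 1) n ≫ f = 0) :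
    ((Ext R (ModuleCat.{u} R) n).obj (Opposite.op X)).obj M :=
  (P.isoExt (R := R) n M).inv ((P.complex.linearYonedaObj R M).homologyπ n
    (HomologicalComplex.cyclesMk (P.complex.linearYonedaObj R M) f (n + 1) (by simp) hf))

variable {X X' : ModuleCat.{u} R} (P : ProjectiveResolution X) {n : ℕ} {M : ModuleCat.{u} R}

theorem derivedExtMk_surjective (y : ((Ext R (ModuleCat.{u} R) n).obj (Opposite.op X)).obj M) :
    ∃ (f : P.complex.X n ⟶ M) (hf : P.complex.d (n + 1) n ≫ f = 0), derivedExtMk P f hf = y := by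
  let K := P.complex.linearYonedaObj R M
  obtain ⟨z, hz⟩ := (ModuleCat.epi_iff_surjective (K.homologyπ n)).1 inferInstance
    ((P.isoExt (R := R) n M).hom y)
  have hf : K.d n (n + 1) (K.iCycles n z) = 0 :=
    ConcreteCategory.congr_hom (K.iCycles_d n (n + 1)) z
  have hz' : HomologicalComplex.cyclesMk K (K.iCycles n z) (n + 1) (by simp) hf = z :=
    (ModuleCat.mono_iff_injective (K.iCycles n)).1 inferInstance
      (HomologicalComplex.i_cyclesMk K _ _ _ _)
  refine ⟨K.iCycles n z, hf, ?_⟩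
  change (P.isoExt (R := R) n M).inv (K.homologyπ n (HomologicalComplex.cyclesMk K _ _ _ hf)) = y
  rw [hz', hz]
  exact ConcreteCategory.congr_hom (P.isoExt (R := R) n M).hom_inv_id y

theorem derivedExtMk_eq_zero_iff (f : P.complex.X (n + 1) ⟶ M)
    (hf : P.complex.d (n + 2) (n + 1) ≫ f = 0) :
    derivedExtMk P f hf = 0 ↔ ∃ k : P.complex.X n ⟶ M, P.complex.d (n + 1) n ≫ k = f := by
  have hinj : Injective (P.isoExt (R := R) (n + 1) M).inv :=
    (ModuleCat.mono_iff_injective _).1 inferInstance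
  refine (map_eq_zero_iff (P.isoExt (R := R) (n + 1) M).inv.hom hinj).trans ?_
  refine (homologyπ_apply_eq_zero_iff _ n _).trans (exists_congr fun k ↦ ?_)
  have := HomologicalComplex.i_cyclesMk (P.complex.linearYonedaObj R M) f (n + 2) (by simp) hf
  exact ⟨fun h ↦ h.trans this, fun h ↦ h.trans this.symm⟩

variable {P} in
theorem map_app_derivedExtMk {P' : ProjectiveResolution X'} {g : X' ⟶ X}
    (φ : ProjectiveResolution.Hom P' P g) (f : P.complex.X n ⟶ M)
    (hf : P.complex.d (n + 1) n ≫ f = 0) :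
    ((Ext R (ModuleCat.{u} R) n).map g.op).app M (derivedExtMk P f hf) =
      derivedExtMk P' (φ.hom.f n ≫ f) (by simp [← φ.hom.comm_assoc, hf]) := by
  have hf' : P'.complex.d (n + 1) n ≫ φ.hom.f n ≫ f = 0 := by simp [← φ.hom.comm_assoc, hf]
  let K := P.complex.linearYonedaObj R M
  let K' := P'.complex.linearYonedaObj R M
  let ψ : K ⟶ K' := linearYonedaObjMap φ.hom M
  let z : K.cycles n := HomologicalComplex.cyclesMk K f (n + 1) (by simp) hf
  let z' : K'.cycles n := HomologicalComplex.cyclesMk K' (φ.hom.f n ≫ f) (n + 1) (by simp) hf'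
  have hz : HomologicalComplex.cyclesMap ψ n z = z' := by
    refine (ModuleCat.mono_iff_injective (K'.iCycles n)).1 inferInstance ?_
    refine (ConcreteCategory.congr_hom (HomologicalComplex.cyclesMap_i ψ n) z).trans ?_
    refine (congrArg (ψ.f n) (HomologicalComplex.i_cyclesMk K _ _ _ hf)).trans ?_
    exact (HomologicalComplex.i_cyclesMk K' _ _ _ hf').symm
  have hmap : HomologicalComplex.homologyMap ψ n (K.homologyπ n z) = K'.homologyπ n z' :=
    (ConcreteCategory.congr_hom (HomologicalComplex.homologyπ_naturality ψ n) z).trans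
      (congrArg (K'.homologyπ n) hz)
  have hnat := isoExt_hom_naturality g P P' φ n M
  rw [← Iso.inv_comp_eq, ← Category.assoc, ← Iso.eq_comp_inv] at hnat
  exact (ConcreteCategory.congr_hom hnat (K.homologyπ n z)).trans
    (congrArg (P'.isoExt (R := R) n M).inv hmap)

/-- Both constructions of `Ext` are compatible with pulling back a cocycle along a map of
resolutions, so they agree on which classes are killed by `g`. -/
theorem map_app_derivedExtMk_eq_zero_iff (g : X' ⟶ X) (f : P.complex.X (n + 1) ⟶ M)
    (hf : P.complex.d (n + 2) (n + 1) ≫ f = 0) :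
    ((Ext R (ModuleCat.{u} R) (n + 1)).map g.op).app M (derivedExtMk P f hf) = 0 ↔
      (Ext.mk₀ g).comp (P.extMk f (n + 2) rfl hf) (zero_add _) = 0 := by
  let P' := projectiveResolution X'
  let φ : ProjectiveResolution.Hom P' P g :=
    ⟨ProjectiveResolution.lift g P' P, ProjectiveResolution.lift_commutes_zero g P' P⟩
  rw [map_app_derivedExtMk φ, derivedExtMk_eq_zero_iff,
    ProjectiveResolution.mk₀_comp_extMk f _ _ hf φ,
    ProjectiveResolution.extMk_eq_zero_iff _ _ _ _ _ n rfl]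

end DerivedExt

theorem subsingleton_of_exact {R L M N : Type*} [Ring R] [AddCommGroup L] [AddCommGroup M]
    [AddCommGroup N] [Module R L] [Module R M] [Module R N] {f : L →ₗ[R] M} {g : M →ₗ[R] N}
    (h : Exact f g) [Subsingleton L] [Subsingleton N] : Subsingleton M :=
  subsingleton_of_forall_eq 0 fun z ↦ by
    obtain ⟨w, rfl⟩ := (h z).1 (Subsingleton.elim _ _)
    rw [Subsingleton.elim w 0, map_zero]

section QuotientProj

variable {R : Type u} [CommRing R]

/-- The projection `R ⧸ I ⟶ R ⧸ J` for `I ≤ J`, as a morphism of `R`-modules. -/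
def quotientProj {I J : Ideal R} (h : I ≤ J) : ModuleCat.of R (R ⧸ I) ⟶ ModuleCat.of R (R ⧸ J) :=
  ModuleCat.ofHom (Submodule.factor h)

theorem quotientProj_refl (I : Ideal R) : quotientProj (le_refl I) = 𝟙 _ := by
  ext
  rfl

theorem quotientProj_comp {I J K : Ideal R} (h : I ≤ J) (h' : J ≤ K) :
    quotientProj h ≫ quotientProj h' = quotientProj (h.trans h') := by
  ext
  rfl

variable {I : Ideal R} {M : ModuleCat.{u} R}

theorem quotient_hom_ext {f g : ModuleCat.of R (R ⧸ I) ⟶ M}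
    (h : f (Submodule.Quotient.mk 1) = g (Submodule.Quotient.mk 1)) : f = g := by
  ext : 1
  exact Submodule.linearMap_qext I (LinearMap.ext_ring h)

theorem smul_quotient_hom_one (f : ModuleCat.of R (R ⧸ I) ⟶ M) {r : R} (hr : r ∈ I) :
    r • f (Submodule.Quotient.mk 1) = 0 := by
  have hmk : r • (Submodule.Quotient.mk 1 : R ⧸ I) = 0 := by
    rw [← Submodule.Quotient.mk_smul, smul_eq_mul, mul_one]
    exact (Submodule.Quotient.mk_eq_zero I).2 hr
  exact (map_smul f.hom r _).symm.trans ((congrArg f.hom hmk).trans (map_zero f.hom))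

theorem smul_ext_quotient_eq_zero {i : ℕ} {r : R} (hr : r ∈ I)
    (x : Abelian.Ext (ModuleCat.of R (R ⧸ I)) M i) : r • x = 0 := by
  have hid : r • 𝟙 (ModuleCat.of R (R ⧸ I)) = 0 :=
    quotient_hom_ext (smul_quotient_hom_one (𝟙 _) hr)
  rw [← Ext.mk₀_id_comp x, ← Ext.smul_comp, ← Ext.mk₀_smul, hid, Ext.mk₀_zero, Ext.zero_comp]

end QuotientProj

section ExtColimit

variable {R : Type u} [CommRing R] (a : Ideal R) (i : ℕ) (M : ModuleCat.{u} R)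

/-- The transition maps of the directed system of the modules `Ext^i(R/a^t, M)`. -/
def extTransition (s t : ℕ) (h : s ≤ t) :
    Abelian.Ext (ModuleCat.of R (R ⧸ a ^ s)) M i →ₗ[R]
      Abelian.Ext (ModuleCat.of R (R ⧸ a ^ t)) M i :=
  (Ext.mk₀ (quotientProj (Ideal.pow_le_pow_right h))).precompOfLinear R M (zero_add i)

theorem extTransition_apply {s t : ℕ} (h : s ≤ t)
    (x : Abelian.Ext (ModuleCat.of R (R ⧸ a ^ s)) M i) :
    extTransition a i M s t h x =
      (Ext.mk₀ (quotientProj (Ideal.pow_le_pow_right h))).comp x (zero_add i) := rfl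

instance : DirectedSystem (fun t : ℕ ↦ Abelian.Ext (ModuleCat.of R (R ⧸ a ^ t)) M i)
    (extTransition a i M · · ·) where
  map_self t x := by rw [extTransition_apply, quotientProj_refl, Ext.mk₀_id_comp]
  map_map _ _ _ h h' x := by
    simp only [extTransition_apply, Ext.mk₀_comp_mk₀_assoc, quotientProj_comp]

/-- The direct limit of the modules `Ext^i(R/a^t, M)`: the `i`-th local cohomology of `M` with
support in `a`, built on `Abelian.Ext` so that its long exact sequences are available. -/
def ExtColimit : Type u :=
  Module.DirectLimit (fun t : ℕ ↦ Abelian.Ext (ModuleCat.of R (R ⧸ a ^ t)) M i)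
    (extTransition a i M)

namespace ExtColimit

instance : AddCommGroup (ExtColimit a i M) :=
  inferInstanceAs (AddCommGroup (Module.DirectLimit _ (extTransition a i M)))

instance : Module R (ExtColimit a i M) :=
  inferInstanceAs (Module R (Module.DirectLimit _ (extTransition a i M)))

/-- The canonical map from `Ext^i(R/a^t, M)` to the direct limit. -/
def of (t : ℕ) : Abelian.Ext (ModuleCat.of R (R ⧸ a ^ t)) M i →ₗ[R] ExtColimit a i M :=
  Module.DirectLimit.of R ℕ _ (extTransition a i M) t

variable {a i M} {N L : ModuleCat.{u} R}

theorem exists_of (z : ExtColimit a i M) : ∃ t x, of a i M t x = z :=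
  Module.DirectLimit.exists_of z

theorem of_transition {s t : ℕ} (h : s ≤ t)
    (x : Abelian.Ext (ModuleCat.of R (R ⧸ a ^ s)) M i) :
    of a i M t ((Ext.mk₀ (quotientProj (Ideal.pow_le_pow_right h))).comp x (zero_add i)) =
      of a i M s x :=
  Module.DirectLimit.of_f (f := extTransition a i M) (hij := h)

theorem of_eq_zero_iff {t : ℕ} {x : Abelian.Ext (ModuleCat.of R (R ⧸ a ^ t)) M i} :
    of a i M t x = 0 ↔ ∃ (s : ℕ) (h : t ≤ s),
      (Ext.mk₀ (quotientProj (Ideal.pow_le_pow_right h))).comp x (zero_add i) = 0 := by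
  refine ⟨fun h ↦ ?_, fun ⟨s, hs, h0⟩ ↦ by rw [← of_transition hs, h0, map_zero]⟩
  obtain ⟨s, hs, h0⟩ := Module.DirectLimit.of.zero_exact (f := extTransition a i M) h
  exact ⟨s, hs, h0⟩

theorem exists_pow_smul_eq_zero {r : R} (hr : r ∈ a) (z : ExtColimit a i M) :
    ∃ t : ℕ, r ^ t • z = 0 := by
  obtain ⟨t, x, rfl⟩ := exists_of z
  exact ⟨t, by rw [← map_smul, smul_ext_quotient_eq_zero (Ideal.pow_mem_pow hr t), map_zero]⟩

variable (a i) in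
/-- The map of direct limits induced by a morphism. It is bundled into `map`, which is linear in
the morphism as well. -/
def mapHom (f : M ⟶ N) : ExtColimit a i M →ₗ[R] ExtColimit a i N :=
  Module.DirectLimit.map (fun t ↦ (Ext.mk₀ f).postcompOfLinear R _ (add_zero i))
    (fun s t h ↦ by
      ext x
      exact Ext.comp_assoc_of_third_deg_zero _ _ _ (zero_add i))

theorem mapHom_of (f : M ⟶ N) {t : ℕ} (x : Abelian.Ext (ModuleCat.of R (R ⧸ a ^ t)) M i) :
    mapHom a i f (of a i M t x) = of a i N t (x.comp (Ext.mk₀ f) (add_zero i)) :=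
  Module.DirectLimit.map_apply_of _ _ _

variable (a i) in
/-- Functoriality of `ExtColimit a i`, as a linear map on `M ⟶ N`. -/
def map : (M ⟶ N) →ₗ[R] ExtColimit a i M →ₗ[R] ExtColimit a i N where
  toFun := mapHom a i
  map_add' f g := by
    ext z
    obtain ⟨t, x, rfl⟩ := exists_of z
    rw [LinearMap.add_apply, mapHom_of, mapHom_of, mapHom_of, Ext.mk₀_add, Ext.comp_add, map_add]
  map_smul' r f := by
    ext z
    obtain ⟨t, x, rfl⟩ := exists_of z
    rw [LinearMap.smul_apply, mapHom_of, mapHom_of, Ext.mk₀_smul, Ext.comp_smul, map_smul]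
    rfl

theorem map_of (f : M ⟶ N) {t : ℕ} (x : Abelian.Ext (ModuleCat.of R (R ⧸ a ^ t)) M i) :
    map a i f (of a i M t x) = of a i N t (x.comp (Ext.mk₀ f) (add_zero i)) :=
  mapHom_of f x

theorem map_id (z : ExtColimit a i M) : map a i (𝟙 M) z = z := by
  obtain ⟨t, x, rfl⟩ := exists_of z
  rw [map_of, Ext.comp_mk₀_id]

theorem map_comp (f : M ⟶ N) (g : N ⟶ L) (z : ExtColimit a i M) :
    map a i (f ≫ g) z = map a i g (map a i f z) := by
  obtain ⟨t, x, rfl⟩ := exists_of z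
  rw [map_of, map_of, map_of, Ext.comp_assoc_of_third_deg_zero, Ext.mk₀_comp_mk₀]

theorem subsingleton_of_iso (e : M ≅ N) [Subsingleton (ExtColimit a i M)] :
    Subsingleton (ExtColimit a i N) :=
  subsingleton_of_forall_eq 0 fun z ↦ by
    rw [← map_id z, ← e.inv_hom_id, map_comp, Subsingleton.elim (map a i e.inv z) 0, map_zero]

section LongExact

variable {S : ShortComplex (ModuleCat.{u} R)} (hS : S.ShortExact)

variable (a i) in
/-- The connecting map of the long exact sequence. -/
def δ : ExtColimit a i S.X₃ →ₗ[R] ExtColimit a (i + 1) S.X₁ :=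
  Module.DirectLimit.map (fun t ↦ hS.extClass.postcompOfLinear R _ rfl)
    (fun s t h ↦ by
      ext x
      exact Ext.comp_assoc _ _ _ (zero_add i) rfl (by lia))

theorem δ_of {t : ℕ} (x : Abelian.Ext (ModuleCat.of R (R ⧸ a ^ t)) S.X₃ i) :
    δ a i hS (of a i S.X₃ t x) = of a (i + 1) S.X₁ t (x.comp hS.extClass rfl) :=
  Module.DirectLimit.map_apply_of _ _ _

include hS

theorem exact₂ : Exact (map a i S.f) (map a i S.g) := by
  refine LinearMap.exact_of_comp_of_mem_range ?_ fun z hz ↦ ?_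
  · ext z
    rw [LinearMap.comp_apply, ← map_comp, S.zero, LinearMap.map_zero]
  obtain ⟨t, x, rfl⟩ := exists_of z
  obtain ⟨s, hs, h0⟩ := of_eq_zero_iff.1 ((map_of S.g x).symm.trans hz)
  rw [← Ext.comp_assoc_of_third_deg_zero] at h0
  obtain ⟨y, hy⟩ := Ext.covariant_sequence_exact₂ _ hS _ h0
  exact ⟨of a i S.X₁ s y, by rw [map_of, hy, of_transition hs]⟩

theorem exact₁ : Exact (δ a i hS) (map a (i + 1) S.f) := by
  refine LinearMap.exact_of_comp_of_mem_range ?_ fun z hz ↦ ?_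
  · ext z
    obtain ⟨t, x, rfl⟩ := exists_of z
    rw [LinearMap.comp_apply, δ_of, map_of, Ext.comp_assoc_of_third_deg_zero, hS.extClass_comp,
      Ext.comp_zero, map_zero, LinearMap.zero_apply]
  obtain ⟨t, x, rfl⟩ := exists_of z
  obtain ⟨s, hs, h0⟩ := of_eq_zero_iff.1 ((map_of S.f x).symm.trans hz)
  rw [← Ext.comp_assoc_of_third_deg_zero] at h0
  obtain ⟨y, hy⟩ := Ext.covariant_sequence_exact₁ _ hS _ h0 rfl
  exact ⟨of a i S.X₃ s y, by rw [δ_of, hy, of_transition hs]⟩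

theorem exact₃ : Exact (map a i S.g) (δ a i hS) := by
  refine LinearMap.exact_of_comp_of_mem_range ?_ fun z hz ↦ ?_
  · ext z
    obtain ⟨t, x, rfl⟩ := exists_of z
    rw [LinearMap.comp_apply, map_of, δ_of, Ext.comp_assoc_of_second_deg_zero, hS.comp_extClass,
      Ext.comp_zero, map_zero, LinearMap.zero_apply]
  obtain ⟨t, x, rfl⟩ := exists_of z
  obtain ⟨s, hs, h0⟩ := of_eq_zero_iff.1 ((δ_of hS x).symm.trans hz)
  rw [← Ext.comp_assoc _ _ _ (zero_add i) rfl (by lia)] at h0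
  obtain ⟨y, hy⟩ := Ext.covariant_sequence_exact₃ _ hS _ rfl h0
  exact ⟨of a i S.X₂ s y, by rw [map_of, hy, of_transition hs]⟩

theorem map_g_surjective [Subsingleton (ExtColimit a (i + 1) S.X₁)] :
    Surjective (map a i S.g) := fun z ↦ (exact₃ hS z).1 (Subsingleton.elim _ _)

theorem subsingleton_X₂ (_ : Subsingleton (ExtColimit a i S.X₁))
    (_ : Subsingleton (ExtColimit a i S.X₃)) : Subsingleton (ExtColimit a i S.X₂) :=
  subsingleton_of_exact (exact₂ hS)

theorem subsingleton_X₃ [Subsingleton (ExtColimit a i S.X₂)]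
    [Subsingleton (ExtColimit a (i + 1) S.X₁)] : Subsingleton (ExtColimit a i S.X₃) :=
  subsingleton_of_exact (exact₃ hS)

/-- If `X₂` is acyclic then `X₁` vanishes in degree `i + 1` iff `H^i(X₂) ⟶ H^i(X₃)` is onto. -/
theorem subsingleton_X₁_iff [Subsingleton (ExtColimit a (i + 1) S.X₂)] :
    Subsingleton (ExtColimit a (i + 1) S.X₁) ↔ Surjective (map a i S.g) := by
  refine ⟨fun _ ↦ map_g_surjective hS, fun h ↦ subsingleton_of_forall_eq 0 fun z ↦ ?_⟩
  obtain ⟨w, rfl⟩ := (exact₁ hS z).1 (Subsingleton.elim _ _)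
  obtain ⟨y, rfl⟩ := h w
  exact (exact₃ hS).apply_apply_eq_zero y

end LongExact
end ExtColimit
end ExtColimit

namespace ExtColimit

variable {R : Type u} [CommRing R] {a : Ideal R} {i : ℕ} {M N : ModuleCat.{u} R}

theorem subsingleton_iff : Subsingleton (ExtColimit a i M) ↔
    ∀ (t : ℕ) (x : Abelian.Ext (ModuleCat.of R (R ⧸ a ^ t)) M i), ∃ (s : ℕ) (h : t ≤ s),
      (Ext.mk₀ (quotientProj (Ideal.pow_le_pow_right h))).comp x (zero_add i) = 0 := by
  refine ⟨fun _ t x ↦ of_eq_zero_iff.1 (Subsingleton.elim (of a i M t x) 0),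
    fun h ↦ subsingleton_of_forall_eq 0 fun z ↦ ?_⟩
  obtain ⟨t, x, rfl⟩ := exists_of z
  exact of_eq_zero_iff.2 (h t x)

theorem isZero_localCohomology_iff :
    IsZero ((localCohomology a (i + 1)).obj M) ↔ Subsingleton (ExtColimit a (i + 1) M) := by
  let D := localCohomology.diagram (localCohomology.idealPowersDiagram a) (i + 1)
  let c := ((evaluation _ _).obj M).mapCocone (colimit.cocone D)
  have hc : IsColimit c := isColimitOfPreserves _ (colimit.isColimit D)
  have : PreservesFilteredColimitsOfSize.{0, 0} (forget (ModuleCat.{u} R)) :=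
    preservesFilteredColimitsOfSize_shrink.{0, u, 0, u} _
  have : PreservesColimit (D ⋙ (evaluation _ _).obj M) (forget (ModuleCat.{u} R)) := inferInstance
  let P (t : ℕ) := projectiveResolution (ModuleCat.of R (R ⧸ a ^ t))
  refine Iff.trans (b := Subsingleton c.pt) ⟨fun h ↦ ModuleCat.subsingleton_of_isZero h,
    fun h ↦ @ModuleCat.isZero_of_subsingleton _ _ _ h⟩ ?_
  rw [subsingleton_iff]
  constructor
  · intro h t x
    obtain ⟨f, hf, rfl⟩ := (P t).extMk_surjective x (i + 2) rfl
    obtain ⟨k, g, g', hg⟩ := Concrete.isColimit_exists_of_rep_eq _ hc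
      (i := Opposite.op (Opposite.op t)) (j := Opposite.op (Opposite.op t))
      (derivedExtMk (P t) f hf) 0 (h.elim _ _)
    exact ⟨k.unop.unop, g.unop.unop.le,
      (map_app_derivedExtMk_eq_zero_iff (P t) _ f hf).1 (hg.trans (map_zero _))⟩
  · intro h
    refine subsingleton_of_forall_eq 0 fun z ↦ ?_
    obtain ⟨j, y, rfl⟩ := Concrete.isColimit_exists_rep _ hc z
    obtain ⟨f, hf, rfl⟩ := derivedExtMk_surjective (P j.unop.unop) y
    obtain ⟨s, hs, h0⟩ := h _ ((P j.unop.unop).extMk f (i + 2) rfl hf)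
    let g : j ⟶ Opposite.op (Opposite.op s) := (homOfLE hs).op.op
    exact (Concrete.isColimit_rep_eq_of_exists (D := c) _ (i := j) (j := j) _ 0
      ⟨_, g, g, ((map_app_derivedExtMk_eq_zero_iff (P j.unop.unop) _ f hf).2 h0).trans
        (map_zero _).symm⟩).trans (map_zero _)

end ExtColimit

/-! ### Torsion modules and change of rings -/

section PowTorsion

variable {R : Type*} [CommRing R] (a : Ideal R) (M : Type*) [AddCommGroup M] [Module R M]

/-- The submodule of the elements killed by some power of `a`, often written `Γ_a(M)`. -/
def powTorsion : Submodule R M where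
  carrier := {x | ∃ t : ℕ, ∀ r ∈ a ^ t, r • x = 0}
  zero_mem' := ⟨0, fun r _ ↦ smul_zero r⟩
  add_mem' := by
    rintro x y ⟨t, ht⟩ ⟨s, hs⟩
    refine ⟨t + s, fun r hr ↦ ?_⟩
    rw [smul_add, ht r (Ideal.pow_le_pow_right (Nat.le_add_right t s) hr),
      hs r (Ideal.pow_le_pow_right (Nat.le_add_left s t) hr), add_zero]
  smul_mem' := by
    rintro c x ⟨t, ht⟩
    exact ⟨t, fun r hr ↦ by rw [smul_comm, ht r hr, smul_zero]⟩

variable {a M}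

theorem map_mem_powTorsion {N : Type*} [AddCommGroup N] [Module R N] (f : M →ₗ[R] N) {x : M}
    (hx : x ∈ powTorsion a M) : f x ∈ powTorsion a N := by
  obtain ⟨t, ht⟩ := hx
  exact ⟨t, fun r hr ↦ by rw [← map_smul, ht r hr, map_zero]⟩

theorem powTorsion_eq_top_of_surjective {N : Type*} [AddCommGroup N] [Module R N]
    {f : M →ₗ[R] N} (hf : Surjective f) (hM : powTorsion a M = ⊤) : powTorsion a N = ⊤ := by
  refine eq_top_iff.2 fun y _ ↦ ?_
  obtain ⟨x, rfl⟩ := hf y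
  exact map_mem_powTorsion f (hM ▸ Submodule.mem_top)

variable (a M) in
theorem powTorsion_powTorsion : powTorsion a (powTorsion a M) = ⊤ := by
  refine eq_top_iff.2 fun ⟨x, t, ht⟩ _ ↦ ⟨t, fun r hr ↦ Subtype.ext (ht r hr)⟩

theorem powTorsion_quotient_self : powTorsion a (R ⧸ a) = ⊤ := eq_top_iff.2 fun y _ ↦
  ⟨1, fun _ hr ↦ Module.mem_annihilator.1 (Ideal.annihilator_quotient.ge (a.pow_one.le hr)) y⟩

theorem exists_pow_smul_apply_eq_zero {W : Type*} [AddCommGroup W] [Module R W]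
    [Module.Finite R W] {f : W →ₗ[R] M} (hf : ∀ w, f w ∈ powTorsion a M) :
    ∃ t : ℕ, ∀ r ∈ a ^ t, ∀ w, r • f w = 0 := by
  obtain ⟨s, hs⟩ := Module.Finite.fg_top (R := R) (M := W)
  choose t ht using hf
  refine ⟨s.sup t, fun r hr w ↦ ?_⟩
  have hker : Submodule.span R s ≤ LinearMap.ker (r • f) := Submodule.span_le.2 fun x hx ↦
    ht x r (Ideal.pow_le_pow_right (Finset.le_sup hx) hr)
  exact hker (hs ▸ Submodule.mem_top)

end PowTorsion

namespace ExtColimit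

variable {R : Type u} [CommRing R] {a : Ideal R} {M N : ModuleCat.{u} R}

/-- Evaluation at `1` of a class in `Ext^0(R/I, M) = Hom(R/I, M)`. -/
def extEval (I : Ideal R) (M : ModuleCat.{u} R) :
    Abelian.Ext (ModuleCat.of R (R ⧸ I)) M 0 →ₗ[R] M :=
  LinearMap.applyₗ (Submodule.Quotient.mk 1) ∘ₗ
    (ModuleCat.homLinearEquiv (S := R)).toLinearMap ∘ₗ Ext.linearEquiv₀.toLinearMap

theorem extEval_mk₀ {I : Ideal R} (f : ModuleCat.of R (R ⧸ I) ⟶ M) :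
    extEval I M (Ext.mk₀ f) = f (Submodule.Quotient.mk 1) :=
  congrArg (fun g ↦ g.hom (Submodule.Quotient.mk 1)) (Ext.addEquiv₀.apply_symm_apply f)

variable (a M) in
/-- The map on the direct limit induced by evaluation at `1`. It identifies the direct limit in
degree zero with `powTorsion a M`. -/
def eval : ExtColimit a 0 M →ₗ[R] M :=
  Module.DirectLimit.lift R ℕ _ (extTransition a 0 M) (fun t ↦ extEval (a ^ t) M)
    (fun s t h x ↦ by
      obtain ⟨f, rfl⟩ := (Ext.mk₀_bijective _ _).2 x
      rw [extTransition_apply, Ext.mk₀_comp_mk₀, extEval_mk₀, extEval_mk₀]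
      rfl)

theorem eval_of {t : ℕ} (f : ModuleCat.of R (R ⧸ a ^ t) ⟶ M) :
    eval a M (of a 0 M t (Ext.mk₀ f)) = f (Submodule.Quotient.mk 1) :=
  (Module.DirectLimit.lift_of _ _ _).trans (extEval_mk₀ f)

theorem exists_of_mk₀ (z : ExtColimit a 0 M) :
    ∃ (t : ℕ) (f : ModuleCat.of R (R ⧸ a ^ t) ⟶ M), of a 0 M t (Ext.mk₀ f) = z := by
  obtain ⟨t, x, rfl⟩ := exists_of z
  obtain ⟨f, rfl⟩ := (Ext.mk₀_bijective _ _).2 x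
  exact ⟨t, f, rfl⟩

theorem eval_injective : Injective (eval a M) := by
  refine (injective_iff_map_eq_zero _).2 fun z hz ↦ ?_
  obtain ⟨t, f, rfl⟩ := exists_of_mk₀ z
  rw [eval_of] at hz
  rw [show f = 0 from quotient_hom_ext hz, Ext.mk₀_zero, map_zero]

theorem range_eval : LinearMap.range (eval a M) = powTorsion a M := by
  ext x
  constructor
  · rintro ⟨z, rfl⟩
    obtain ⟨t, f, rfl⟩ := exists_of_mk₀ z
    rw [eval_of]
    exact ⟨t, fun r hr ↦ smul_quotient_hom_one f hr⟩
  · rintro ⟨t, ht⟩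
    refine ⟨of a 0 M t (Ext.mk₀ (ModuleCat.ofHom
      (Submodule.liftQ (a ^ t) (LinearMap.toSpanSingleton R M x) ht))), ?_⟩
    exact (eval_of _).trans (one_smul R x)

theorem eval_map (f : M ⟶ N) (z : ExtColimit a 0 M) : eval a N (map a 0 f z) = f (eval a M z) := by
  obtain ⟨t, g, rfl⟩ := exists_of_mk₀ z
  rw [map_of, Ext.mk₀_comp_mk₀, eval_of, eval_of]
  rfl

theorem surjective_map_zero_iff (f : M ⟶ N) : Surjective (map a 0 f) ↔
    ∀ y ∈ powTorsion a N, ∃ x ∈ powTorsion a M, f x = y := by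
  simp only [← range_eval, LinearMap.mem_range, forall_exists_index, forall_apply_eq_imp_iff,
    exists_exists_eq_and, ← eval_map, eval_injective.eq_iff]
  rfl

end ExtColimit

section Acyclic

variable {R : Type u} [CommRing R]

/-- Modules without higher local cohomology with support in `a`. -/
def IsAcyclic (a : Ideal R) (M : ModuleCat.{u} R) : Prop :=
  ∀ i, Subsingleton (ExtColimit a (i + 1) M)

namespace IsAcyclic

variable {a : Ideal R} {M : ModuleCat.{u} R}

theorem of_injective [Injective M] : IsAcyclic a M := fun i ↦
  ExtColimit.subsingleton_iff.2 fun t x ↦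
    ⟨t, le_rfl, by rw [Ext.eq_zero_of_injective x, Ext.comp_zero]⟩

theorem of_iso {N : ModuleCat.{u} R} (hM : IsAcyclic a M) (e : M ≅ N) : IsAcyclic a N := fun i ↦
  have := hM i
  ExtColimit.subsingleton_of_iso e

variable {S : ShortComplex (ModuleCat.{u} R)}

theorem subsingleton_one_iff (h : IsAcyclic a S.X₂) (hS : S.ShortExact) :
    Subsingleton (ExtColimit a 1 S.X₁) ↔
      ∀ y ∈ powTorsion a S.X₃, ∃ x ∈ powTorsion a S.X₂, S.g x = y :=
  have := h 0
  (ExtColimit.subsingleton_X₁_iff hS).trans (ExtColimit.surjective_map_zero_iff S.g)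

theorem subsingleton_add_two_iff (h : IsAcyclic a S.X₂) (hS : S.ShortExact) {i : ℕ} :
    Subsingleton (ExtColimit a (i + 2) S.X₁) ↔ Subsingleton (ExtColimit a (i + 1) S.X₃) := by
  have := h i
  have := h (i + 1)
  exact ⟨fun _ ↦ ExtColimit.subsingleton_X₃ hS, fun _ ↦
    (ExtColimit.subsingleton_X₁_iff hS).2 fun z ↦ ⟨0, Subsingleton.elim _ _⟩⟩

theorem of_resolving {κ : Type*} {X : κ → ModuleCat.{u} R}
    (h : ∀ k, ∃ (k' : κ) (E : ModuleCat.{u} R) (f : X k ⟶ E) (g : E ⟶ X k') (w : f ≫ g = 0),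
      (ShortComplex.mk f g w).ShortExact ∧ IsAcyclic a E ∧
        ∀ y ∈ powTorsion a (X k'), ∃ x ∈ powTorsion a E, g x = y)
    (k : κ) : IsAcyclic a (X k) := by
  intro i
  induction i generalizing k with
  | zero =>
    obtain ⟨k', E, f, g, w, hS, hE, hsurj⟩ := h k
    exact (subsingleton_one_iff (S := .mk f g w) hE hS).2 hsurj
  | succ i ih =>
    obtain ⟨k', E, f, g, w, hS, hE, -⟩ := h k
    exact (subsingleton_add_two_iff (S := .mk f g w) hE hS).2 (ih k')

end IsAcyclic

end Acyclic

section InjectiveTorsion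

variable {R : Type u} [CommRing R] [IsNoetherianRing R] (a : Ideal R)

/-- By Artin–Rees a map from an ideal `b` to torsion factors through `b/(b ∩ a^n)`, hence extends
to `R/a^n` with values in the injective module. -/
theorem injective_powTorsion (E : Type u) [AddCommGroup E] [Module R E] [Module.Injective R E] :
    Module.Injective R (powTorsion a E) := by
  refine Module.Baer.injective fun b φ ↦ ?_
  obtain ⟨k, hk⟩ := exists_pow_smul_apply_eq_zero (f := (powTorsion a E).subtype ∘ₗ φ)
    (fun w ↦ (φ w).2)
  obtain ⟨n, hn⟩ : ∃ n, a ^ n ⊓ b ≤ a ^ k • b := by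
    obtain ⟨c, hc⟩ := a.exists_pow_inf_eq_pow_smul b
    have hle := (hc (c + k) (Nat.le_add_right c k)).le
    rw [smul_eq_mul, Ideal.mul_top, Nat.add_sub_cancel_left] at hle
    refine ⟨c + k, hle.trans ?_⟩
    exact Submodule.smul_mono le_rfl inf_le_right
  let p : Submodule R b := Submodule.comap b.subtype (a ^ n)
  have hker : p ≤ LinearMap.ker ((powTorsion a E).subtype ∘ₗ φ) := fun x hx ↦ by
    have hle : a ^ k • b ≤ (LinearMap.ker ((powTorsion a E).subtype ∘ₗ φ)).map b.subtype :=
      Submodule.smul_le.2 fun r hr z hz ↦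
        ⟨r • ⟨z, hz⟩, (map_smul _ r (⟨z, hz⟩ : b)).trans (hk r hr _), rfl⟩
    obtain ⟨y, hy, hyx⟩ := hle (hn ⟨hx, x.2⟩)
    rwa [← Subtype.ext hyx]
  have hinj : Injective (Submodule.mapQ p (a ^ n) b.subtype le_rfl) := by
    rw [← LinearMap.ker_eq_bot, Submodule.mapQ, Submodule.ker_liftQ_eq_bot]
    exact fun x hx ↦ (Submodule.Quotient.mk_eq_zero (a ^ n)).1 hx
  obtain ⟨h, hh⟩ := Module.Injective.out _ hinj (Submodule.liftQ p _ hker)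
  refine ⟨LinearMap.codRestrict _ (h ∘ₗ Submodule.mkQ _) fun r ↦ ⟨n, fun s hs ↦ ?_⟩,
    fun x hx ↦ Subtype.ext (hh (Submodule.Quotient.mk ⟨x, hx⟩))⟩
  have hsr : s • r ∈ a ^ n := Ideal.mul_mem_right _ _ hs
  rw [← map_smul, LinearMap.comp_apply, Submodule.mkQ_apply,
    (Submodule.Quotient.mk_eq_zero _).2 hsr, map_zero]

theorem exists_mono_injective_powTorsion {M : ModuleCat.{u} R} (hM : powTorsion a M = ⊤) :
    ∃ (E : ModuleCat.{u} R) (j : M ⟶ E), Mono j ∧ Injective E ∧ powTorsion a E = ⊤ := by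
  let E₀ : ModuleCat.{u} R := Injective.under M
  have : Module.Injective R E₀ := Module.injective_module_of_injective_object R _
    (inj := inferInstanceAs (Injective (Injective.under M)))
  have := injective_powTorsion a E₀
  have hι : Function.Injective (Injective.ι M) :=
    (ModuleCat.mono_iff_injective (Injective.ι M)).1 inferInstance
  refine ⟨ModuleCat.of R (powTorsion a E₀), ModuleCat.ofHom (LinearMap.codRestrict _
    (Injective.ι M).hom fun x ↦ map_mem_powTorsion _ (hM ▸ Submodule.mem_top)), ?_,
    Module.injective_object_of_injective_module _ _, powTorsion_powTorsion a E₀⟩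
  exact (ModuleCat.mono_iff_injective _).2 fun x y hxy ↦ hι (congrArg Subtype.val hxy)

variable {a} in
theorem IsAcyclic.of_powTorsion_eq_top {M : ModuleCat.{u} R} (hM : powTorsion a M = ⊤) :
    IsAcyclic a M := by
  refine of_resolving (X := fun M : {M : ModuleCat.{u} R // powTorsion a M = ⊤} ↦ M.1)
    (fun ⟨M, hM⟩ ↦ ?_) ⟨M, hM⟩
  obtain ⟨E, j, _, _, hE⟩ := exists_mono_injective_powTorsion a hM
  have hS : (ShortComplex.mk j (cokernel.π j) (cokernel.condition j)).ShortExact :=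
    { exact := ShortComplex.exact_cokernel j }
  refine ⟨⟨cokernel j, powTorsion_eq_top_of_surjective (f := (cokernel.π j).hom)
    hS.moduleCat_surjective_g hE⟩, E, j, _, _, hS, .of_injective, fun y _ ↦ ?_⟩
  obtain ⟨x, hx⟩ := hS.moduleCat_surjective_g y
  exact ⟨x, hE ▸ Submodule.mem_top, hx⟩

end InjectiveTorsion

section HomAcyclic

variable {R : Type u} [CommRing R] (D : Type u) [AddCommGroup D] [Module R D]
  [Module.Injective R D]

theorem shortExact_lcomp_ker {W F : Type u} [AddCommGroup W] [Module R W] [AddCommGroup F]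
    [Module R F] {f : F →ₗ[R] W} (hf : Surjective f) :
    (ShortComplex.mk (ModuleCat.ofHom (LinearMap.lcomp R D f))
      (ModuleCat.ofHom (LinearMap.lcomp R D (LinearMap.ker f).subtype))
      (by ext φ x; exact (congrArg φ x.2).trans (map_zero φ))).ShortExact := by
  refine ModuleCat.shortComplex_shortExact _ ?_ (LinearMap.lcomp_injective_of_surjective f hf) ?_
  · exact LinearMap.exact_lcomp_of_exact_of_surjective D f.exact_subtype_ker_map hf
  · intro φ
    obtain ⟨h, hh⟩ := Module.Injective.out (LinearMap.ker f).subtype Subtype.val_injective φ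
    exact ⟨h, LinearMap.ext hh⟩

theorem injective_linearMap_of_free (F : Type u) [AddCommGroup F] [Module R F] [Module.Free R F] :
    Module.Injective R (F →ₗ[R] D) :=
  Module.Baer.injective (Module.Baer.of_equiv ((Module.Free.chooseBasis R F).constr R)
    (Module.Baer.of_injective inferInstance))

theorem IsAcyclic.linearMap [IsNoetherianRing R] (a : Ideal R) (W : Type u) [AddCommGroup W]
    [Module R W] [Module.Finite R W] : IsAcyclic a (ModuleCat.of R (W →ₗ[R] D)) := by
  refine of_resolving (X := fun W : {W : ModuleCat.{u} R // Module.Finite R W} ↦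
    ModuleCat.of R (W.1 →ₗ[R] D)) (fun ⟨W, _⟩ ↦ ?_) ⟨ModuleCat.of R W, ‹_›⟩
  obtain ⟨n, f, hf⟩ := Module.Finite.exists_fin' R W
  have := injective_linearMap_of_free (R := R) D (Fin n → R)
  have : Injective (ModuleCat.of R ((Fin n → R) →ₗ[R] D)) :=
    Module.injective_object_of_injective_module _ _
  refine ⟨⟨ModuleCat.of R (LinearMap.ker f), inferInstance⟩, _, _, _, _,
    shortExact_lcomp_ker D hf, .of_injective, ?_⟩
  rintro φ ⟨t, ht⟩
  have := injective_powTorsion a D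
  obtain ⟨h, hh⟩ := Module.Injective.out (LinearMap.ker f).subtype Subtype.val_injective
    (LinearMap.codRestrict (powTorsion a D) φ fun x ↦ ⟨t, fun r hr ↦
      LinearMap.congr_fun (ht r hr) x⟩)
  obtain ⟨s, hs⟩ := exists_pow_smul_apply_eq_zero (f := (powTorsion a D).subtype ∘ₗ h)
    (fun w ↦ (h w).2)
  exact ⟨(powTorsion a D).subtype ∘ₗ h, ⟨s, fun r hr ↦ LinearMap.ext fun w ↦ hs r hr w⟩,
    LinearMap.ext fun x ↦ congrArg Subtype.val (hh x)⟩

end HomAcyclic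

section BaseChange

variable {R T : Type u} [CommRing R] [CommRing T] (φ : R →+* T) (a : Ideal R)

theorem mem_powTorsion_restrictScalars_iff {M : ModuleCat.{u} T} {x : M} :
    (show (ModuleCat.restrictScalars φ).obj M from x) ∈
      powTorsion a ((ModuleCat.restrictScalars φ).obj M) ↔ x ∈ powTorsion (a.map φ) M := by
  refine exists_congr fun t ↦ ?_
  rw [← Ideal.map_pow]
  exact ⟨fun ht r hr ↦ (Ideal.map_le_iff_le_comap (K := LinearMap.ker
    (LinearMap.toSpanSingleton T M x))).2 ht hr, fun ht r hr ↦ ht _ (Ideal.mem_map_of_mem φ hr)⟩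

theorem subsingleton_restrictScalars_iff_of_acyclic
    (h : ∀ M : ModuleCat.{u} T, ∃ (E : ModuleCat.{u} T) (j : M ⟶ E), Mono j ∧
      IsAcyclic (a.map φ) E ∧ IsAcyclic a ((ModuleCat.restrictScalars φ).obj E))
    (i : ℕ) (M : ModuleCat.{u} T) :
    Subsingleton (ExtColimit a (i + 1) ((ModuleCat.restrictScalars φ).obj M)) ↔
      Subsingleton (ExtColimit (a.map φ) (i + 1) M) := by
  induction i using Nat.strong_induction_on generalizing M with | _ i ih
  obtain ⟨E, j, _, hE, hE'⟩ := h M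
  let S := ShortComplex.mk j (cokernel.π j) (cokernel.condition j)
  have hS : S.ShortExact := { exact := ShortComplex.exact_cokernel j }
  let S' := S.map (ModuleCat.restrictScalars φ)
  have hS' : S'.ShortExact := hS.map_of_exact (ModuleCat.restrictScalars φ)
  rcases i with _ | i
  · refine (IsAcyclic.subsingleton_one_iff (S := S') hE' hS').trans
      (Iff.trans ?_ (IsAcyclic.subsingleton_one_iff (S := S) hE hS).symm)
    exact forall_congr' fun y ↦ imp_congr (mem_powTorsion_restrictScalars_iff φ a)
      (exists_congr fun x ↦ and_congr_left' (mem_powTorsion_restrictScalars_iff φ a))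
  · exact (IsAcyclic.subsingleton_add_two_iff (S := S') hE' hS').trans
      ((ih i i.lt_succ_self S.X₃).trans (IsAcyclic.subsingleton_add_two_iff (S := S) hE hS).symm)

variable {φ}

theorem subsingleton_restrictScalars_iff_of_flat (hφ : φ.Flat) (i : ℕ) (M : ModuleCat.{u} T) :
    Subsingleton (ExtColimit a (i + 1) ((ModuleCat.restrictScalars φ).obj M)) ↔
      Subsingleton (ExtColimit (a.map φ) (i + 1) M) := by
  refine subsingleton_restrictScalars_iff_of_acyclic φ a (fun M ↦ ?_) i M
  have := ModuleCat.preservesFiniteLimits_extendScalars_of_flat hφ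
  have := Injective.injective_of_adjoint (ModuleCat.extendRestrictScalarsAdj.{u} φ)
    (Injective.under M)
  exact ⟨Injective.under M, Injective.ι M, inferInstance, .of_injective, .of_injective⟩

theorem mono_homEquiv_restrictCoextendScalarsAdj {M : ModuleCat.{u} T} {D : ModuleCat.{u} R}
    (f : (ModuleCat.restrictScalars φ).obj M ⟶ D) [Mono f] :
    Mono ((ModuleCat.restrictCoextendScalarsAdj.{u} φ).homEquiv M D f) := by
  let adj := ModuleCat.restrictCoextendScalarsAdj.{u} φ
  have hf : (ModuleCat.restrictScalars φ).map (adj.homEquiv M D f) ≫ adj.counit.app D = f :=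
    (adj.homEquiv_counit M D _).symm.trans (Equiv.symm_apply_apply _ _)
  have : Mono ((ModuleCat.restrictScalars φ).map (adj.homEquiv M D f)) :=
    mono_of_mono_fac hf
  exact (ModuleCat.restrictScalars φ).mono_of_mono_map this

theorem IsAcyclic.restrictScalars_coextendScalars [IsNoetherianRing R] (hφ : φ.Finite)
    (D : ModuleCat.{u} R) [Module.Injective R D] :
    IsAcyclic a ((ModuleCat.restrictScalars φ).obj ((ModuleCat.coextendScalars φ).obj D)) := by
  let W := (ModuleCat.restrictScalars φ).obj (ModuleCat.of T T)
  have : Module.Finite R W := hφ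
  let e : (W →ₗ[R] D) ≃ₗ[R]
      (ModuleCat.restrictScalars φ).obj ((ModuleCat.coextendScalars φ).obj D) :=
    { toFun := fun f ↦ f
      invFun := fun f ↦ f
      map_add' := fun _ _ ↦ rfl
      map_smul' := fun r f ↦ LinearMap.ext fun (t : T) ↦ (f.map_smul r t).symm.trans
        (congrArg (fun s : T ↦ f (show W from s)) (mul_comm (φ r) t))
      left_inv := fun _ ↦ rfl
      right_inv := fun _ ↦ rfl }
  exact (IsAcyclic.linearMap D a W).of_iso e.toModuleIso

theorem subsingleton_restrictScalars_iff_of_finite [IsNoetherianRing R] (hφ : φ.Finite) (i : ℕ)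
    (M : ModuleCat.{u} T) :
    Subsingleton (ExtColimit a (i + 1) ((ModuleCat.restrictScalars φ).obj M)) ↔
      Subsingleton (ExtColimit (a.map φ) (i + 1) M) := by
  refine subsingleton_restrictScalars_iff_of_acyclic φ a (fun M ↦ ?_) i M
  let D := Injective.under ((ModuleCat.restrictScalars φ).obj M)
  have : Injective D := inferInstanceAs (Injective (Injective.under _))
  have : Module.Injective R D := Module.injective_module_of_injective_object R D
  have := Injective.injective_of_adjoint (ModuleCat.restrictCoextendScalarsAdj.{u} φ) D
  exact ⟨_, _, mono_homEquiv_restrictCoextendScalarsAdj (Injective.ι _), .of_injective,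
    .restrictScalars_coextendScalars a hφ D⟩

end BaseChange

/-! ### Generic matrices of powers -/

section RegularMod

variable {T D A : Type*} [CommRing T] [AddCommGroup D] [Module T D] [CommRing A] [Algebra T A]
  {ι : D →ₗ[T] A} {N : Submodule T D} {x y : D}

/-- Multiplication by the linear form `w` is injective in degree one modulo the linear forms in
`N`. Here `ι : D → A` realises `D` as the linear forms in a commutative algebra, so that
`N.map ι * LinearMap.range ι` consists of the quadratic forms generated by `N`. -/
def IsRegularMod (ι : D →ₗ[T] A) (N : Submodule T D) (w : D) : Prop :=
  ∀ g, ι w * ι g ∈ N.map ι * LinearMap.range ι → g ∈ N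

theorem mem_map_sup_span_mul_range_iff {q : A} :
    q ∈ (N ⊔ Submodule.span T {y}).map ι * LinearMap.range ι ↔
      ∃ h, q - ι y * ι h ∈ N.map ι * LinearMap.range ι := by
  rw [Submodule.map_sup, Submodule.map_span, Set.image_singleton, Submodule.sup_mul,
    Submodule.mem_sup']
  constructor
  · rintro ⟨p, ⟨_, hp⟩, rfl⟩
    obtain ⟨_, ⟨h, rfl⟩, rfl⟩ := Submodule.mem_span_singleton_mul.1 hp
    exact ⟨h, by simp⟩
  · rintro ⟨h, hq⟩
    exact ⟨⟨_, hq⟩, ⟨_, Submodule.mem_span_singleton_mul.2 ⟨ι h, ⟨h, rfl⟩, rfl⟩⟩, by simp⟩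

theorem mem_sup_span_singleton_iff {v : D} :
    v ∈ N ⊔ Submodule.span T {y} ↔ ∃ c : T, v - c • y ∈ N := by
  simp only [Submodule.mem_sup, Submodule.mem_span_singleton]
  constructor
  · rintro ⟨n, hn, _, ⟨c, rfl⟩, rfl⟩
    exact ⟨c, by simpa using hn⟩
  · rintro ⟨c, hc⟩
    exact ⟨_, hc, _, ⟨c, rfl⟩, by simp⟩

theorem mul_mem_map_mul_range {n : D} (hn : n ∈ N) (g : D) :
    ι g * ι n ∈ N.map ι * LinearMap.range ι :=
  mul_comm (ι n) (ι g) ▸ Submodule.mul_mem_mul (Submodule.mem_map_of_mem hn) ⟨g, rfl⟩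

namespace IsRegularMod

theorem swap (hx : IsRegularMod ι N x) (hy : IsRegularMod ι (N ⊔ Submodule.span T {x}) y) :
    IsRegularMod ι (N ⊔ Submodule.span T {y}) x := by
  intro g hg
  obtain ⟨h, hgh⟩ := mem_map_sup_span_mul_range_iff.1 hg
  have hyh : ι y * ι h ∈ (N ⊔ Submodule.span T {x}).map ι * LinearMap.range ι :=
    mem_map_sup_span_mul_range_iff.2 ⟨g, neg_sub (ι x * ι g) (ι y * ι h) ▸ neg_mem hgh⟩
  obtain ⟨c, hc⟩ := mem_sup_span_singleton_iff.1 (hy h hyh)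
  refine mem_sup_span_singleton_iff.2 ⟨c, hx _ ?_⟩
  have hsum := add_mem hgh (mul_mem_map_mul_range hc y)
  have hexpand : ι x * ι g - ι y * ι h + ι y * ι (h - c • x) = ι x * ι (g - c • y) := by
    simp only [map_sub, map_smul, mul_sub, mul_smul_comm, mul_comm (ι x) (ι y), sub_add_sub_cancel]
  exact hexpand ▸ hsum

theorem mem_colon (hx : IsRegularMod ι N x) {s : T} (hs : s • x ∈ N) :
    s ∈ N.colon Set.univ :=
  Submodule.mem_colon.2 fun g _ ↦ hx _ <| by
    rw [map_smul, mul_smul_comm, ← smul_mul_assoc, ← map_smul, mul_comm (ι _)]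
    exact mul_mem_map_mul_range hs g

/-- The algebra map `ψ` takes the relation `ι w * ι g ∈ N` to the corresponding relation
for `ι'`. -/
theorem comap {T' D' A' : Type*} [CommRing T'] [AddCommGroup D'] [Module T' D'] [CommRing A']
    [Algebra T' A'] {ι' : D' →ₗ[T'] A'} {N' : Submodule T' D'} {σ : T →+* T'}
    [RingHomSurjective σ] {w : D} (π : D →ₛₗ[σ] D') (ψ : A →+* A')
    (hψ : ∀ d, ψ (ι d) = ι' (π d)) (h : IsRegularMod ι' N' (π w)) :
    IsRegularMod ι (N'.comap π) w := by
  have hmap : ∀ q ∈ (N'.comap π).map ι * LinearMap.range ι,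
      ψ q ∈ N'.map ι' * LinearMap.range ι' := by
    intro q hq
    induction hq using Submodule.mul_induction_on' with
    | mem_mul_mem p hp r hr =>
      obtain ⟨n, hn, rfl⟩ := hp
      obtain ⟨d, rfl⟩ := hr
      rw [map_mul, hψ, hψ]
      exact Submodule.mul_mem_mul (Submodule.mem_map_of_mem hn) ⟨_, rfl⟩
    | add p _ r _ hp hr => rw [map_add]; exact add_mem hp hr
  intro g hg
  exact h _ (by simpa only [map_mul, hψ] using hmap _ hg)

end IsRegularMod

/-- The linear forms `x, y` form a regular sequence in degree one modulo `N`, in either order. -/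
structure IsRegularPair (ι : D →ₗ[T] A) (N : Submodule T D) (x y : D) : Prop where
  left : IsRegularMod ι N x
  right : IsRegularMod ι N y
  right_mod_left : IsRegularMod ι (N ⊔ Submodule.span T {x}) y

/-- The pairs `(s, t)` for which `s • x` and `t • y` agree modulo `N`. -/
def proportionality (N : Submodule T D) (x y : D) : Submodule T (T × T) :=
  N.comap ((LinearMap.toSpanSingleton T D x).coprod (-LinearMap.toSpanSingleton T D y))

theorem mem_proportionality {s t : T} :
    (s, t) ∈ proportionality N x y ↔ s • x - t • y ∈ N := by
  simp [proportionality, sub_eq_add_neg]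

theorem mk_swap_mem_proportionality_iff {s t : T} :
    (t, s) ∈ proportionality N y x ↔ (s, t) ∈ proportionality N x y := by
  rw [mem_proportionality, mem_proportionality, ← neg_mem_iff, neg_sub]

theorem exists_mem_proportionality {s : T}
    (hs : s ∈ (N ⊔ Submodule.span T {y}).colon Set.univ) :
    ∃ t, (s, t) ∈ proportionality N x y := by
  simpa only [mem_proportionality] using
    mem_sup_span_singleton_iff.1 (Submodule.mem_colon.1 hs x trivial)

namespace IsRegularPair

theorem left_mod_right (h : IsRegularPair ι N x y) :
    IsRegularMod ι (N ⊔ Submodule.span T {y}) x :=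
  h.left.swap h.right_mod_left

theorem symm (h : IsRegularPair ι N x y) : IsRegularPair ι N y x :=
  ⟨h.right, h.left, h.left_mod_right⟩

theorem fst_mem_colon (h : IsRegularPair ι N x y) {s t : T}
    (hst : (s, t) ∈ proportionality N x y) : s ∈ (N ⊔ Submodule.span T {y}).colon Set.univ :=
  h.left_mod_right.mem_colon (mem_sup_span_singleton_iff.2 ⟨t, mem_proportionality.1 hst⟩)

theorem snd_mem_colon (h : IsRegularPair ι N x y) {s t : T}
    (hst : (s, t) ∈ proportionality N x y) : t ∈ (N ⊔ Submodule.span T {x}).colon Set.univ :=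
  h.symm.fst_mem_colon (mk_swap_mem_proportionality_iff.2 hst)

theorem snd_mem_colon_of_fst_mem (h : IsRegularPair ι N x y) {s t : T}
    (hst : (s, t) ∈ proportionality N x y) (hs : s ∈ N.colon Set.univ) :
    t ∈ N.colon Set.univ :=
  h.right.mem_colon <| by
    simpa using sub_mem (Submodule.mem_colon.1 hs x trivial) (mem_proportionality.1 hst)

theorem fst_mem_colon_iff_snd_mem (h : IsRegularPair ι N x y) {s t : T}
    (hst : (s, t) ∈ proportionality N x y) :
    s ∈ N.colon Set.univ ↔ t ∈ N.colon Set.univ :=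
  ⟨h.snd_mem_colon_of_fst_mem hst,
    h.symm.snd_mem_colon_of_fst_mem (mk_swap_mem_proportionality_iff.2 hst)⟩

end IsRegularPair

end RegularMod

section GenericMatrix

variable {T : Type*} [CommRing T] {m r : ℕ}

/-- The column space of a matrix. -/
def colSpan (X : Matrix (Fin m) (Fin r) T) : Submodule T (Fin m → T) :=
  Submodule.span T (Set.range X.col)

/-- The linear form on `T ^ m` with the given coefficients, as a polynomial function. -/
def linearForm (T : Type*) [CommRing T] (m : ℕ) : (Fin m → T) →ₗ[T] ((Fin m → T) → T) :=
  LinearMap.pi fun v ↦ (dotProductBilin T T).flip v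

theorem linearForm_apply (g v : Fin m → T) : linearForm T m g v = g ⬝ᵥ v := rfl

theorem mem_colSpan {X : Matrix (Fin m) (Fin r) T} {g : Fin m → T} :
    g ∈ colSpan X ↔ ∃ c, X.mulVec c = g := by
  rw [colSpan, ← Matrix.range_mulVecLin]
  rfl

theorem colSpan_succ (X : Matrix (Fin m) (Fin (r + 1)) T) :
    colSpan X = colSpan (X.submatrix id Fin.succ) ⊔ Submodule.span T {X.col 0} := by
  rw [colSpan, colSpan, ← Submodule.span_union, ← Fin.cons_self_tail X.col, Fin.range_cons,
    Set.insert_eq, Set.union_comm]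
  rfl

theorem comap_funLeft_colSpan (X : Matrix (Fin (m + 1)) (Fin r) T) :
    (colSpan (X.submatrix Fin.succ id)).comap (LinearMap.funLeft T T Fin.succ) =
      colSpan X ⊔ Submodule.span T {Pi.single 0 1} := by
  have hmap : colSpan (X.submatrix Fin.succ id) =
      (colSpan X).map (LinearMap.funLeft T T Fin.succ) := by
    rw [colSpan, colSpan, Submodule.map_span, ← Set.range_comp]
    rfl
  have hker : LinearMap.ker (LinearMap.funLeft T T (Fin.succ : Fin m → Fin (m + 1))) =
      Submodule.span T {Pi.single 0 1} := by
    ext g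
    rw [LinearMap.mem_ker, Submodule.mem_span_singleton]
    constructor
    · intro hg
      refine ⟨g 0, funext <| Fin.cases (by simp) fun i ↦ ?_⟩
      simpa using (congrFun hg i).symm
    · rintro ⟨c, rfl⟩
      ext i
      simp [LinearMap.funLeft_apply]
  rw [hmap, Submodule.comap_map_eq, hker]

theorem IsRegularMod.of_submatrix_succ {X : Matrix (Fin (m + 1)) (Fin r) T} {w : Fin (m + 1) → T}
    (h : IsRegularMod (linearForm T m) (colSpan (X.submatrix Fin.succ id)) (w ∘ Fin.succ)) :
    IsRegularMod (linearForm T (m + 1)) (colSpan X ⊔ Submodule.span T {Pi.single 0 1}) w := by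
  rw [← comap_funLeft_colSpan]
  refine IsRegularMod.comap _
    (RingHom.pi fun v : Fin m → T ↦ Pi.evalRingHom (fun _ ↦ T) (Fin.cons 0 v)) (fun d ↦ ?_) h
  ext v
  change linearForm T (m + 1) d (Fin.cons 0 v) = _
  simp [linearForm_apply, dotProduct, Fin.sum_univ_succ, LinearMap.funLeft_apply]

theorem IsRegularMod.of_ringEquiv {T' : Type*} [CommRing T'] (e : T ≃+* T')
    {X : Matrix (Fin m) (Fin r) T} {w : Fin m → T}
    (h : IsRegularMod (linearForm T' m) (colSpan (X.map e)) (e ∘ w)) :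
    IsRegularMod (linearForm T m) (colSpan X) w := by
  let π : (Fin m → T) →ₛₗ[(e : T →+* T')] (Fin m → T') :=
    { toFun := fun d ↦ e ∘ d
      map_add' := fun d d' ↦ funext fun i ↦ map_add e _ _
      map_smul' := fun c d ↦ funext fun i ↦ map_mul e _ _ }
  have hcomap : (colSpan (X.map e)).comap π = colSpan X := by
    ext g
    rw [Submodule.mem_comap, mem_colSpan, mem_colSpan]
    constructor
    · rintro ⟨c, hc⟩
      refine ⟨e.symm ∘ c, funext fun i ↦ e.injective ?_⟩
      simpa [Matrix.mulVec, dotProduct, π] using congrFun hc i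
    · rintro ⟨c, rfl⟩
      exact ⟨e ∘ c, funext fun i ↦ by simp [Matrix.mulVec, dotProduct, π]⟩
  have := h.comap (w := w) (ι := linearForm T m) π (RingHom.pi fun v : Fin m → T' ↦
    (e : T →+* T').comp (Pi.evalRingHom (fun _ ↦ T) (e.symm ∘ v))) fun d ↦ by
      ext v
      change e (linearForm T m d (e.symm ∘ v)) = _
      simp [linearForm_apply, dotProduct, π]
  rwa [hcomap] at this

open Polynomial in
theorem mem_colSpan_map_C_iff {M : Matrix (Fin m) (Fin r) T} {g : Fin m → T[X]} :
    g ∈ colSpan (M.map C) ↔ ∀ n, (fun i ↦ (g i).coeff n) ∈ colSpan M := by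
  constructor
  · rintro h n
    obtain ⟨c, rfl⟩ := mem_colSpan.1 h
    exact mem_colSpan.2 ⟨fun j ↦ (c j).coeff n, funext fun i ↦ by
      simp [Matrix.mulVec, dotProduct]⟩
  · intro h
    choose c hc using fun n ↦ mem_colSpan.1 (h n)
    let d : ℕ := Finset.univ.sup fun i ↦ (g i).natDegree
    refine mem_colSpan.2 ⟨fun j ↦ ∑ n ∈ Finset.range (d + 1), C (c n j) * X ^ n, funext fun i ↦ ?_⟩
    have hi : (g i).natDegree < d + 1 :=
      Nat.lt_succ_of_le (Finset.le_sup (f := fun i ↦ (g i).natDegree) (Finset.mem_univ i))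
    have hcoeff : ∀ n, (g i).coeff n = ∑ j, M i j * c n j := fun n ↦ (congrFun (hc n) i).symm
    rw [(g i).as_sum_range_C_mul_X_pow' hi]
    simp only [hcoeff, Matrix.mulVec, dotProduct, Matrix.map_apply, Finset.mul_sum,
      map_sum, Finset.sum_mul, map_mul, mul_assoc]
    exact Finset.sum_comm

open Polynomial in
theorem coeff_linearForm_C (g : Fin m → T[X]) (v : Fin m → T) (n : ℕ) :
    (linearForm T[X] m g (C ∘ v)).coeff n = linearForm T m (fun i ↦ (g i).coeff n) v := by
  simp [linearForm_apply, dotProduct]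

open Polynomial in
theorem coeff_mem_of_mem_colSpan_map_C {M : Matrix (Fin m) (Fin r) T} (n : ℕ)
    {q : (Fin m → T[X]) → T[X]}
    (hq : q ∈ (colSpan (M.map C)).map (linearForm T[X] m) * LinearMap.range (linearForm T[X] m)) :
    (fun v : Fin m → T ↦ (q (C ∘ v)).coeff n) ∈
      (colSpan M).map (linearForm T m) * LinearMap.range (linearForm T m) := by
  induction hq using Submodule.mul_induction_on' with
  | mem_mul_mem p hp q hq =>
    obtain ⟨g, hg, rfl⟩ := hp
    obtain ⟨h, rfl⟩ := hq
    have : (fun v : Fin m → T ↦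
          ((linearForm T[X] m g * linearForm T[X] m h) (C ∘ v)).coeff n) =
        ∑ k ∈ Finset.HasAntidiagonal.antidiagonal n, linearForm T m (fun i ↦ (g i).coeff k.1) *
          linearForm T m (fun i ↦ (h i).coeff k.2) := by
      ext v
      simp [coeff_mul, coeff_linearForm_C]
    rw [this]
    exact sum_mem fun k _ ↦ Submodule.mul_mem_mul
      (Submodule.mem_map_of_mem (mem_colSpan_map_C_iff.1 hg k.1)) ⟨_, rfl⟩
  | add p _ q _ hp hq =>
    simp only [Pi.add_apply, coeff_add]
    exact add_mem hp hq

open Polynomial in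
/-- Comparing coefficients of `X ^ (n + e)` shows that the coefficients of `g` lie in the column
space by descending induction on `n`. -/
theorem IsRegularMod.X_pow_mul_C_add_C {M : Matrix (Fin m) (Fin r) T} {y : Fin m → T}
    (hy : IsRegularMod (linearForm T m) (colSpan M) y) {e : ℕ} (he : 0 < e) (u : Fin m → T) :
    IsRegularMod (linearForm T[X] m) (colSpan (M.map C)) fun i ↦ X ^ e * C (y i) + C (u i) := by
  intro g hg
  let d : ℕ := Finset.univ.sup fun i ↦ (g i).natDegree
  suffices ∀ k n, d < n + k → (fun i ↦ (g i).coeff n) ∈ colSpan M from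
    mem_colSpan_map_C_iff.2 fun n ↦ this (d + 1) n (by omega)
  intro k
  induction k with
  | zero =>
    intro n hn
    have : (fun i ↦ (g i).coeff n) = 0 := funext fun i ↦ coeff_eq_zero_of_natDegree_lt <|
      (Finset.le_sup (f := fun i ↦ (g i).natDegree) (Finset.mem_univ i)).trans_lt hn
    exact this ▸ zero_mem _
  | succ k ih =>
    intro n hn
    refine hy _ ?_
    have hu := mul_mem_map_mul_range (ι := linearForm T m) (ih (n + e) (by omega)) u
    convert sub_mem (coeff_mem_of_mem_colSpan_map_C (n + e) hg) hu using 1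
    ext v
    have hw : linearForm T[X] m (fun i ↦ X ^ e * C (y i) + C (u i)) (C ∘ v) =
        X ^ e * C (linearForm T m y v) + C (linearForm T m u v) := by
      simp only [linearForm_apply, dotProduct, comp_apply, add_mul, Finset.sum_add_distrib,
        Finset.mul_sum, map_sum, map_mul, mul_assoc]
    simp only [Pi.sub_apply, Pi.mul_apply, hw, add_mul, mul_assoc, coeff_add, coeff_X_pow_mul,
      coeff_C_mul, coeff_linearForm_C, add_sub_cancel_right]

end GenericMatrix

section PowMatrix

open MvPolynomial

/-- The matrix of `e`-th powers of the variables indexed by `ι`. -/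
def powMatrix (k : Type*) [CommRing k] {σ : Type*} (e : ℕ) {m r : ℕ} (ι : Fin m → Fin r → σ) :
    Matrix (Fin m) (Fin r) (MvPolynomial σ k) :=
  Matrix.of fun i j ↦ X (ι i j) ^ e

theorem powMatrix_submatrix (k : Type*) [CommRing k] {σ : Type*} (e : ℕ) {m r m' r' : ℕ}
    (ι : Fin m → Fin r → σ) (f : Fin m' → Fin m) (g : Fin r' → Fin r) :
    (powMatrix k e ι).submatrix f g = powMatrix k e fun i j ↦ ι (f i) (g j) := rfl

theorem exists_ringEquiv_polynomial (k : Type*) [CommRing k] {σ : Type*} (s : σ) :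
    ∃ E : MvPolynomial σ k ≃+* Polynomial (MvPolynomial {j : σ // j ≠ s} k),
      E (X s) = Polynomial.X ∧ ∀ j (hj : j ≠ s), E (X j) = Polynomial.C (X ⟨j, hj⟩) := by
  classical
  refine ⟨((renameEquiv k (Equiv.optionSubtypeNe s).symm).trans
    (optionEquivLeft k {j : σ // j ≠ s})).toRingEquiv, ?_, fun j hj ↦ ?_⟩
  · simp [optionEquivLeft_apply]
  · simp [optionEquivLeft_apply, Equiv.optionSubtypeNe_symm_of_ne hj]

theorem injective2_comp {α β α' β' γ : Type*} {ι : α → β → γ} (hι : Injective2 ι) {f : α' → α}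
    {g : β' → β} (hf : Injective f) (hg : Injective g) : Injective2 fun i j ↦ ι (f i) (g j) :=
  fun _ _ _ _ h ↦ ⟨hf (hι h).1, hg (hι h).2⟩

variable {k : Type*} [CommRing k] {σ : Type v} {e m r : ℕ}

theorem isRegularMod_bot_single (T : Type*) [CommRing T] (m : ℕ) :
    IsRegularMod (linearForm T (m + 1)) ⊥ (Pi.single 0 1) := by
  intro g hg
  rw [Submodule.map_bot, Submodule.bot_mul, Submodule.mem_bot] at hg
  have hv (v : Fin (m + 1) → T) : v 0 * g ⬝ᵥ v = 0 := by
    simpa [linearForm_apply] using congrFun hg v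
  have h0 : g 0 = 0 := by simpa using hv (Pi.single 0 1)
  refine funext <| Fin.cases h0 fun i ↦ ?_
  simpa [dotProduct, Fin.sum_univ_succ, Pi.single_apply, h0] using hv (Fin.cons 1 (Pi.single i 1))

/-- The variable `ι 0 0` occurs in the first column, but in no other column. -/
theorem isRegularMod_powMatrix_col_zero_of_single (he : 0 < e)
    (h : ∀ (τ : Type v) (n : ℕ) (κ : Fin (n + 1) → Fin r → τ), Injective2 κ →
      IsRegularMod (linearForm _ (n + 1)) (colSpan (powMatrix k e κ)) (Pi.single 0 1))
    (ι : Fin m → Fin (r + 1) → σ) (hι : Injective2 ι) :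
    IsRegularMod (linearForm _ m) (colSpan ((powMatrix k e ι).submatrix id Fin.succ))
      ((powMatrix k e ι).col 0) := by
  cases m with
  | zero => exact fun g _ ↦ Subsingleton.elim 0 g ▸ zero_mem _
  | succ m =>
    obtain ⟨E, hEs, hE⟩ := exists_ringEquiv_polynomial k (ι 0 0)
    have hne (i : Fin (m + 1)) (j : Fin r) : ι i j.succ ≠ ι 0 0 :=
      fun hij ↦ j.succ_ne_zero (hι hij).2
    have hne' (i : Fin m) : ι i.succ 0 ≠ ι 0 0 := fun hij ↦ i.succ_ne_zero (hι hij).1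
    let κ (i : Fin (m + 1)) (j : Fin r) : {j : σ // j ≠ ι 0 0} := ⟨ι i j.succ, hne i j⟩
    have hκ : Injective2 κ := fun i i' j j' hij ↦
      injective2_comp hι injective_id (Fin.succ_injective r) (congrArg Subtype.val hij)
    refine IsRegularMod.of_ringEquiv E ?_
    have hmap : ((powMatrix k e ι).submatrix id Fin.succ).map E =
        (powMatrix k e κ).map Polynomial.C := by
      ext1 i j
      simp [powMatrix, hE _ (hne i j), κ]
    have hcol : E ∘ (powMatrix k e ι).col 0 = fun i ↦ Polynomial.X ^ e *
        Polynomial.C ((Pi.single 0 1 : Fin (m + 1) → MvPolynomial _ k) i) +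
          Polynomial.C ((Fin.cons 0 fun i ↦ X ⟨_, hne' i⟩ ^ e : Fin (m + 1) → _) i) :=
      funext <| Fin.cases (by simp [powMatrix, hEs]) fun i ↦ by simp [powMatrix, hE _ (hne' i)]
    rw [hmap, hcol]
    exact (h _ _ κ hκ).X_pow_mul_C_add_C he _

theorem col_powMatrix_comp_succ (ι : Fin (m + 1) → Fin r → σ) (j : Fin r) :
    (powMatrix k e ι).col j ∘ Fin.succ = (powMatrix k e fun i j ↦ ι i.succ j).col j := rfl

theorem isRegularMod_powMatrix_single (he : 0 < e) :
    ∀ {r : ℕ} {σ : Type v} {m : ℕ} (ι : Fin (m + 1) → Fin r → σ), Injective2 ι →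
      IsRegularMod (linearForm _ (m + 1)) (colSpan (powMatrix k e ι)) (Pi.single 0 1) := by
  intro r
  induction r with
  | zero =>
    intro σ m ι _
    have hbot : colSpan (powMatrix k e ι) = ⊥ := by simp [colSpan]
    exact hbot ▸ isRegularMod_bot_single _ m
  | succ r ih =>
    intro σ m ι hι
    have hsingle := ih _ (injective2_comp hι injective_id (Fin.succ_injective r))
    have hcol := isRegularMod_powMatrix_col_zero_of_single (k := k) he (fun _ _ κ hκ ↦ ih κ hκ) _
      (injective2_comp hι (Fin.succ_injective m) injective_id)
    rw [powMatrix_submatrix] at hcol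
    rw [colSpan_succ, powMatrix_submatrix]
    apply hsingle.swap
    apply IsRegularMod.of_submatrix_succ
    rw [powMatrix_submatrix, col_powMatrix_comp_succ]
    exact hcol

theorem isRegularMod_powMatrix_col_zero (he : 0 < e) (ι : Fin m → Fin (r + 1) → σ)
    (hι : Injective2 ι) :
    IsRegularMod (linearForm _ m) (colSpan ((powMatrix k e ι).submatrix id Fin.succ))
      ((powMatrix k e ι).col 0) :=
  isRegularMod_powMatrix_col_zero_of_single he
    (fun _ _ κ hκ ↦ isRegularMod_powMatrix_single he κ hκ) ι hι

theorem isRegularPair_powMatrix (he : 0 < e) (ι : Fin (m + 1) → Fin (r + 1) → σ)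
    (hι : Injective2 ι) :
    IsRegularPair (linearForm _ (m + 1)) (colSpan ((powMatrix k e ι).submatrix id Fin.succ))
      (Pi.single 0 1) ((powMatrix k e ι).col 0) := by
  have hrow := isRegularMod_powMatrix_col_zero (k := k) he _
    (injective2_comp hι (Fin.succ_injective m) injective_id)
  refine ⟨?_, isRegularMod_powMatrix_col_zero he ι hι, .of_submatrix_succ ?_⟩
  · rw [powMatrix_submatrix]
    exact isRegularMod_powMatrix_single he _
      (injective2_comp hι injective_id (Fin.succ_injective r))
  · rw [powMatrix_submatrix] at hrow
    rw [powMatrix_submatrix, powMatrix_submatrix, col_powMatrix_comp_succ]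
    exact hrow

end PowMatrix

/-! ### Ideals of maximal minors -/

section Colon

variable {T : Type*} [CommRing T] {m r : ℕ}

theorem comap_colon_univ {D D' : Type*} [AddCommGroup D] [AddCommGroup D'] [Module T D]
    [Module T D'] {π : D →ₗ[T] D'} (hπ : Surjective π) (N : Submodule T D') :
    (N.comap π).colon Set.univ = N.colon Set.univ := by
  ext s
  simp [Submodule.mem_colon, hπ.forall]

theorem colon_colSpan_submatrix_succ (X : Matrix (Fin (m + 1)) (Fin (r + 1)) T) :
    (colSpan (X.submatrix Fin.succ Fin.succ)).colon Set.univ =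
      (colSpan (X.submatrix id Fin.succ) ⊔ Submodule.span T {Pi.single 0 1}).colon Set.univ := by
  rw [← comap_funLeft_colSpan, comap_colon_univ]
  · rfl
  exact LinearMap.funLeft_surjective_of_injective _ _ _ (Fin.succ_injective m)

end Colon

section Minors

variable {T : Type u} [CommRing T] {m r : ℕ}

theorem minorsIdeal_zero (X : Matrix (Fin m) (Fin r) T) : X.minorsIdeal 0 = ⊤ := by
  rw [Ideal.eq_top_iff_one]
  exact Ideal.subset_span ⟨Fin.castLEOrderEmb (Nat.zero_le _), Fin.castLEOrderEmb (Nat.zero_le _),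
    by simp⟩

theorem minorsIdeal_eq_bot (X : Matrix (Fin m) (Fin r) T) {t : ℕ} (h : r < t) :
    X.minorsIdeal t = ⊥ := by
  refine le_bot_iff.1 (Ideal.span_le.2 ?_)
  rintro _ ⟨f, g, rfl⟩
  have hcard := Fintype.card_le_of_injective g g.injective
  simp only [Fintype.card_fin] at hcard
  omega

theorem coe_orderEmbedding_fin (f : Fin m ↪o Fin m) : (f : Fin m → Fin m) = id :=
  (f.strictMono.range_inj strictMono_id).1 <| by
    rw [Set.range_id, Set.range_eq_univ]
    exact Finite.surjective_of_injective f.injective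

theorem minorsIdeal_submatrix_succ_le (X : Matrix (Fin m) (Fin (r + 1)) T) (t : ℕ) :
    (X.submatrix id Fin.succ).minorsIdeal t ≤ X.minorsIdeal t := by
  refine Ideal.span_le.2 ?_
  rintro _ ⟨f, g, rfl⟩
  exact Ideal.subset_span ⟨f, g.trans (Fin.succOrderEmb r), rfl⟩

theorem colSpan_submatrix_le {s : ℕ} (X : Matrix (Fin m) (Fin r) T) (g : Fin s → Fin r) :
    colSpan (X.submatrix id g) ≤ colSpan X :=
  Submodule.span_mono (Set.range_subset_iff.2 fun j ↦ ⟨g j, rfl⟩)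

theorem det_smul_eq_mulVec (X : Matrix (Fin m) (Fin m) T) (v : Fin m → T) :
    X.det • v = X.mulVec (X.adjugate.mulVec v) := by
  rw [Matrix.mulVec_mulVec, Matrix.mul_adjugate, Matrix.smul_mulVec, Matrix.one_mulVec]

theorem minorsIdeal_le_colon (X : Matrix (Fin m) (Fin r) T) :
    X.minorsIdeal m ≤ (colSpan X).colon Set.univ := by
  refine Ideal.span_le.2 ?_
  rintro _ ⟨f, g, rfl⟩
  refine Submodule.mem_colon.2 fun v _ ↦ colSpan_submatrix_le X g ?_
  rw [coe_orderEmbedding_fin f, det_smul_eq_mulVec]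
  exact mem_colSpan.2 ⟨_, rfl⟩

theorem det_mk_det_submatrix_succ_mem_proportionality (B : Matrix (Fin (m + 1)) (Fin (m + 1)) T) :
    (B.det, (B.submatrix Fin.succ Fin.succ).det) ∈
      proportionality (colSpan (B.submatrix id Fin.succ)) (Pi.single 0 1) (B.col 0) := by
  let c := B.adjugate.mulVec (Pi.single 0 1)
  have hc : c 0 = (B.submatrix Fin.succ Fin.succ).det := by
    simp only [c, Matrix.mulVec_single_one, Matrix.col_apply,
      Matrix.adjugate_fin_succ_eq_det_submatrix, Fin.succAbove_zero]
    simp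
  refine mem_proportionality.2 (mem_colSpan.2 ⟨c ∘ Fin.succ, ?_⟩)
  rw [det_smul_eq_mulVec, ← hc]
  ext i
  simp [Matrix.mulVec, dotProduct, Fin.sum_univ_succ, c, mul_comm]

theorem proportionality_mono {D : Type*} [AddCommGroup D] [Module T D] {N N' : Submodule T D}
    (h : N ≤ N') (x y : D) : proportionality N x y ≤ proportionality N' x y :=
  Submodule.comap_mono h

theorem exists_mem_minorsIdeal_mem_proportionality (X : Matrix (Fin (m + 1)) (Fin (r + 1)) T)
    {t : T} (ht : t ∈ (X.submatrix Fin.succ Fin.succ).minorsIdeal m) :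
    ∃ s ∈ X.minorsIdeal (m + 1),
      (s, t) ∈ proportionality (colSpan (X.submatrix id Fin.succ)) (Pi.single 0 1) (X.col 0) := by
  let L := proportionality (colSpan (X.submatrix id Fin.succ)) (Pi.single 0 1) (X.col 0)
  suffices h : (X.submatrix Fin.succ Fin.succ).minorsIdeal m ≤
      (L ⊓ Submodule.comap (LinearMap.fst T T T) (X.minorsIdeal (m + 1))).map
        (LinearMap.snd T T T) by
    obtain ⟨⟨s, _⟩, ⟨hL, hs⟩, rfl⟩ := h ht
    exact ⟨s, hs, hL⟩
  refine Submodule.span_le.2 ?_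
  rintro _ ⟨f, c, rfl⟩
  let c' : Fin (m + 1) ↪o Fin (r + 1) := OrderEmbedding.ofStrictMono
    (Fin.cons 0 fun j ↦ (c j).succ) (Fin.strictMono_cons.2
      ⟨fun _ ↦ Fin.succ_pos _, Fin.strictMono_succ.comp c.strictMono⟩)
  refine ⟨(_, _), ⟨?_, Ideal.subset_span ⟨RelEmbedding.refl _, c', rfl⟩⟩, rfl⟩
  have hdet := det_mk_det_submatrix_succ_mem_proportionality (X.submatrix id c')
  rw [coe_orderEmbedding_fin f]
  exact proportionality_mono (colSpan_submatrix_le (X.submatrix id Fin.succ) c) _ _ hdet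

theorem colon_colSpan_powMatrix {k : Type v} [CommRing k] {e : ℕ} (he : 0 < e) {σ : Type w}
    (ι : Fin m → Fin r → σ) (hι : Injective2 ι) :
    (colSpan (powMatrix k e ι)).colon Set.univ = (powMatrix k e ι).minorsIdeal m := by
  refine le_antisymm ?_ (minorsIdeal_le_colon _)
  induction r generalizing m with
  | zero =>
    rcases m with _ | m
    · rw [minorsIdeal_zero]
      exact le_top
    · intro s hs
      have hbot : colSpan (powMatrix k e ι) = ⊥ := by simp [colSpan]
      have := Submodule.mem_colon.1 hs (Pi.single 0 1) trivial
      rw [hbot, Submodule.mem_bot] at this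
      have : s = 0 := by simpa using congrFun this 0
      exact this ▸ zero_mem _
  | succ r ih =>
    rcases m with _ | m
    · rw [minorsIdeal_zero]
      exact le_top
    have hpair := isRegularPair_powMatrix (k := k) he ι hι
    intro s hs
    rw [colSpan_succ] at hs
    obtain ⟨t, hst⟩ := exists_mem_proportionality (x := Pi.single 0 1) hs
    have ht : t ∈ ((powMatrix k e ι).submatrix Fin.succ Fin.succ).minorsIdeal m := by
      refine ih _ (injective2_comp hι (Fin.succ_injective m) (Fin.succ_injective r)) ?_
      rw [← powMatrix_submatrix, colon_colSpan_submatrix_succ]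
      exact hpair.snd_mem_colon hst
    obtain ⟨s', hs', hst'⟩ := exists_mem_minorsIdeal_mem_proportionality _ ht
    have hdiff := sub_mem hst hst'
    rw [Prod.mk_sub_mk, sub_self] at hdiff
    have : s - s' ∈ (powMatrix k e ι).minorsIdeal (m + 1) :=
      minorsIdeal_submatrix_succ_le _ _ <|
        ih _ (injective2_comp hι injective_id (Fin.succ_injective r)) <|
          (hpair.fst_mem_colon_iff_snd_mem hdiff).2 (zero_mem _)
    exact (Submodule.sub_mem_iff_left _ hs').1 this

end Minors

section ProjectiveDimension

section

variable {T : Type*} [CommRing T]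

theorem map_mkQ_eq_ker_factor {M : Type*} [AddCommGroup M] [Module T M] {I J : Submodule T M}
    (h : I ≤ J) : J.map I.mkQ = LinearMap.ker (Submodule.factor h) := by
  rw [Submodule.factor, Submodule.ker_mapQ, Submodule.comap_id]

/-- The correspondence `L` identifies both `J₁ ⧸ I` and `J₂ ⧸ I` with the quotient of `L` by the
pairs having an entry in `I`. -/
theorem nonempty_ker_factor_equiv {M : Type*} [AddCommGroup M] [Module T M]
    {I J₁ J₂ : Submodule T M} (L : Submodule T (M × M)) (h₁ : I ≤ J₁) (h₂ : I ≤ J₂)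
    (hL₁ : L.map (LinearMap.fst T M M) = J₁) (hL₂ : L.map (LinearMap.snd T M M) = J₂)
    (hI : ∀ x ∈ L, x.1 ∈ I ↔ x.2 ∈ I) :
    Nonempty (LinearMap.ker (Submodule.factor h₁) ≃ₗ[T] LinearMap.ker (Submodule.factor h₂)) := by
  let f₁ : L →ₗ[T] M ⧸ I := (I.mkQ ∘ₗ LinearMap.fst T M M).domRestrict L
  let f₂ : L →ₗ[T] M ⧸ I := (I.mkQ ∘ₗ LinearMap.snd T M M).domRestrict L
  have hker : LinearMap.ker f₁ = LinearMap.ker f₂ := by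
    ext x
    simpa [f₁, f₂] using hI _ x.2
  have hrange₁ : LinearMap.range f₁ = LinearMap.ker (Submodule.factor h₁) := by
    rw [LinearMap.range_domRestrict, Submodule.map_comp, hL₁, map_mkQ_eq_ker_factor]
  have hrange₂ : LinearMap.range f₂ = LinearMap.ker (Submodule.factor h₂) := by
    rw [LinearMap.range_domRestrict, Submodule.map_comp, hL₂, map_mkQ_eq_ker_factor]
  exact ⟨(LinearEquiv.ofEq _ _ hrange₁).symm ≪≫ₗ f₁.quotKerEquivRange.symm ≪≫ₗ
    Submodule.quotEquivOfEq _ _ hker ≪≫ₗ f₂.quotKerEquivRange ≪≫ₗ LinearEquiv.ofEq _ _ hrange₂⟩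

end

variable {T : Type u} [CommRing T]

theorem hasProjectiveDimensionLT_of_ker_factor_equiv {I J₁ J₂ : Ideal T} (h₁ : I ≤ J₁)
    (h₂ : I ≤ J₂)
    (E : LinearMap.ker (Submodule.factor h₁) ≃ₗ[T] LinearMap.ker (Submodule.factor h₂))
    {n : ℕ} (hI : HasProjectiveDimensionLT (ModuleCat.of T (T ⧸ I)) n)
    (hJ₁ : HasProjectiveDimensionLT (ModuleCat.of T (T ⧸ J₁)) (n + 1)) :
    HasProjectiveDimensionLT (ModuleCat.of T (T ⧸ J₂)) (n + 1) := by
  have hS₁ := LinearMap.shortExact_shortComplexKer (Submodule.factor_surjective h₁)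
  have hS₂ := LinearMap.shortExact_shortComplexKer (Submodule.factor_surjective h₂)
  have hK := hS₁.hasProjectiveDimensionLT_X₁ n hI hJ₁
  exact hS₂.hasProjectiveDimensionLT_X₃ n (hasProjectiveDimensionLT_of_iso E.toModuleIso n)
    (hasProjectiveDimensionLT_of_ge _ n _ n.le_succ)

namespace IsRegularPair

variable {D A : Type*} [AddCommGroup D] [Module T D] [CommRing A] [Algebra T A]
  {ι : D →ₗ[T] A} {N : Submodule T D} {x y : D}

theorem map_fst_proportionality (h : IsRegularPair ι N x y) :
    (proportionality N x y).map (LinearMap.fst T T T) =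
      (N ⊔ Submodule.span T {y}).colon Set.univ := by
  ext s
  constructor
  · rintro ⟨⟨s, t⟩, hst, rfl⟩
    exact h.fst_mem_colon hst
  · intro hs
    obtain ⟨t, hst⟩ := exists_mem_proportionality (x := x) hs
    exact ⟨_, hst, rfl⟩

theorem map_snd_proportionality (h : IsRegularPair ι N x y) :
    (proportionality N x y).map (LinearMap.snd T T T) =
      (N ⊔ Submodule.span T {x}).colon Set.univ := by
  rw [← h.symm.map_fst_proportionality]
  ext t
  constructor
  · rintro ⟨⟨s, t⟩, hst, rfl⟩
    exact ⟨_, mk_swap_mem_proportionality_iff.2 hst, rfl⟩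
  · rintro ⟨⟨t, s⟩, hst, rfl⟩
    exact ⟨_, mk_swap_mem_proportionality_iff.1 hst, rfl⟩

theorem hasProjectiveDimensionLT (h : IsRegularPair ι N x y) {n : ℕ}
    (hN : HasProjectiveDimensionLT (ModuleCat.of T (T ⧸ N.colon Set.univ)) n)
    (hx : HasProjectiveDimensionLT
      (ModuleCat.of T (T ⧸ (N ⊔ Submodule.span T {x}).colon Set.univ)) (n + 1)) :
    HasProjectiveDimensionLT
      (ModuleCat.of T (T ⧸ (N ⊔ Submodule.span T {y}).colon Set.univ)) (n + 1) := by
  obtain ⟨E⟩ := nonempty_ker_factor_equiv _ (Submodule.colon_mono le_sup_left subset_rfl)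
    (Submodule.colon_mono le_sup_left subset_rfl) h.map_fst_proportionality
    h.map_snd_proportionality fun p hp ↦ h.fst_mem_colon_iff_snd_mem hp
  exact hasProjectiveDimensionLT_of_ker_factor_equiv _ _ E.symm hN hx

end IsRegularPair

theorem hasProjectiveDimensionLT_quotient_top (n : ℕ) :
    HasProjectiveDimensionLT (ModuleCat.of T (T ⧸ (⊤ : Ideal T))) n := by
  have := Ideal.Quotient.subsingleton_iff.2 (rfl : (⊤ : Ideal T) = ⊤)
  have := (hasProjectiveDimensionLT_zero_iff_isZero _).2
    (ModuleCat.isZero_of_subsingleton (ModuleCat.of T (T ⧸ (⊤ : Ideal T))))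
  exact hasProjectiveDimensionLT_of_ge _ 0 _ n.zero_le

theorem hasProjectiveDimensionLT_quotient_bot :
    HasProjectiveDimensionLT (ModuleCat.of T (T ⧸ (⊥ : Ideal T))) 1 := by
  rw [← projective_iff_hasProjectiveDimensionLT_one, ← IsProjective.iff_projective]
  exact Module.Projective.of_equiv (Submodule.quotEquivOfEqBot _ rfl).symm

/-- The bound is that of the Eagon–Northcott complex. -/
theorem hasProjectiveDimensionLT_quotient_minorsIdeal_powMatrix {k : Type v} [CommRing k] {e : ℕ}
    (he : 0 < e) {σ : Type w} {m r : ℕ} (ι : Fin m → Fin r → σ) (hι : Injective2 ι)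
    (hmr : m ≤ r + 1) :
    HasProjectiveDimensionLT (ModuleCat.of (MvPolynomial σ k)
      (MvPolynomial σ k ⧸ (powMatrix k e ι).minorsIdeal m)) (r + 2 - m) := by
  induction r generalizing m with
  | zero =>
    rcases m with _ | m
    · rw [minorsIdeal_zero]
      exact hasProjectiveDimensionLT_quotient_top _
    · obtain rfl : m = 0 := by omega
      rw [minorsIdeal_eq_bot _ (Nat.lt_succ_self _)]
      exact hasProjectiveDimensionLT_quotient_bot
  | succ r ih =>
    rcases m with _ | m
    · rw [minorsIdeal_zero]
      exact hasProjectiveDimensionLT_quotient_top _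
    obtain rfl | hm : m = r + 1 ∨ m ≤ r := by omega
    · rw [minorsIdeal_eq_bot _ (Nat.lt_succ_self _), Nat.add_sub_cancel_left (r + 1 + 1) 1]
      exact hasProjectiveDimensionLT_quotient_bot
    have hι₁ := injective2_comp hι injective_id (Fin.succ_injective r)
    have hι₂ := injective2_comp hι (Fin.succ_injective m) (Fin.succ_injective r)
    have hN := ih _ hι₁ (by omega)
    have hx := ih _ hι₂ (by omega)
    rw [← colon_colSpan_powMatrix he _ hι₁, ← powMatrix_submatrix k e ι id Fin.succ] at hN
    rw [← colon_colSpan_powMatrix he _ hι₂, ← powMatrix_submatrix k e ι Fin.succ Fin.succ,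
      colon_colSpan_submatrix_succ, show r + 2 - m = r + 2 - (m + 1) + 1 by omega] at hx
    rw [← colon_colSpan_powMatrix he _ hι, colSpan_succ,
      show r + 1 + 2 - (m + 1) = r + 2 - (m + 1) + 1 by omega]
    exact (isRegularPair_powMatrix he ι hι).hasProjectiveDimensionLT hN hx

end ProjectiveDimension

/-! ### The upper bound in positive characteristic -/

section UpperBound

variable {R : Type u} [CommRing R] {m n : ℕ}

theorem minorsIdeal_map {S : Type u} [CommRing S] (φ : R →+* S) (A : Matrix (Fin m) (Fin n) R)
    (t : ℕ) : (A.minorsIdeal t).map φ = (A.map φ).minorsIdeal t := by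
  rw [Matrix.minorsIdeal, Ideal.map_span, Matrix.minorsIdeal]
  congr 1
  ext x
  constructor
  · rintro ⟨_, ⟨f, g, rfl⟩, rfl⟩
    exact ⟨f, g, RingHom.map_det φ _⟩
  · rintro ⟨f, g, rfl⟩
    exact ⟨_, ⟨f, g, rfl⟩, RingHom.map_det φ _⟩

theorem minorsIdeal_transpose_le (A : Matrix (Fin m) (Fin n) R) (t : ℕ) :
    A.transpose.minorsIdeal t ≤ A.minorsIdeal t := by
  refine Ideal.span_mono ?_
  rintro _ ⟨f, g, rfl⟩
  exact ⟨g, f, Matrix.det_transpose (A.submatrix g f)⟩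

theorem minorsIdeal_transpose (A : Matrix (Fin m) (Fin n) R) (t : ℕ) :
    A.transpose.minorsIdeal t = A.minorsIdeal t :=
  (minorsIdeal_transpose_le A t).antisymm (minorsIdeal_transpose_le A.transpose t)

/-- The Frobenius powers of `I` are cofinal with the ordinary powers, so that the transition maps
factor through groups `Ext^i(R/I^[p^e], M)`, which vanish. -/
theorem ExtColimit.subsingleton_of_frobenius (p : ℕ) [Fact p.Prime] [CharP R p]
    {I : Ideal R} (hfg : I.FG) {d : ℕ}
    (hI : ∀ e, HasProjectiveDimensionLT (ModuleCat.of R (R ⧸ I.map (iterateFrobenius R p e))) d)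
    {i : ℕ} (hi : d ≤ i) (M : ModuleCat.{u} R) : Subsingleton (ExtColimit I i M) := by
  refine subsingleton_iff.2 fun t x ↦ ?_
  have hle : I.map (iterateFrobenius R p t) ≤ I ^ t := by
    refine Ideal.map_le_iff_le_comap.2 fun r hr ↦ ?_
    rw [Ideal.mem_comap, iterateFrobenius_def]
    exact Ideal.pow_le_pow_right (Nat.lt_pow_self (Fact.out : p.Prime).one_lt).le
      (Ideal.pow_mem_pow hr _)
  obtain ⟨s, hs⟩ : ∃ s, I ^ s ≤ I.map (iterateFrobenius R p t) :=
    Ideal.exists_pow_le_of_le_radical_of_fg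
      (fun r hr ↦ ⟨p ^ t, iterateFrobenius_def (R := R) p t r ▸ Ideal.mem_map_of_mem _ hr⟩) hfg
  have hge : I ^ max t s ≤ I.map (iterateFrobenius R p t) :=
    (Ideal.pow_le_pow_right (le_max_right t s)).trans hs
  have := hI t
  refine ⟨max t s, le_max_left t s, ?_⟩
  rw [← quotientProj_comp hge hle, ← Ext.mk₀_comp_mk₀_assoc,
    Ext.eq_zero_of_hasProjectiveDimensionLT ((Ext.mk₀ (quotientProj hle)).comp x (zero_add i)) d hi,
    Ext.comp_zero]

theorem map_powMatrix_iterateFrobenius {k : Type*} [CommRing k] (p : ℕ) [ExpChar k p] {σ : Type*}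
    (ι : Fin m → Fin n → σ) (e : ℕ) :
    (powMatrix k 1 ι).map (iterateFrobenius (MvPolynomial σ k) p e) = powMatrix k (p ^ e) ι := by
  ext1 i j
  simp [powMatrix, iterateFrobenius_def]

/-- The matrix is a specialization of the generic one over `MvPolynomial _ R`, where the
Frobenius powers of the ideal of minors are the ideals of minors of the matrices of powers. -/
theorem subsingleton_extColimit_minorsIdeal_of_charP (p : ℕ) [Fact p.Prime] [CharP R p]
    [IsNoetherianRing R] (hmn : m ≤ n) (A : Matrix (Fin m) (Fin n) R) {i : ℕ} (hi : n - m < i)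
    (M : ModuleCat.{u} R) : Subsingleton (ExtColimit (A.minorsIdeal m) (i + 1) M) := by
  let ι : Fin m → Fin n → Fin m × Fin n := Prod.mk
  have hι : Injective2 ι := fun _ _ _ _ h ↦ Prod.mk.inj h
  let φ : MvPolynomial (Fin m × Fin n) R →+* R := (MvPolynomial.aeval fun x ↦ A x.1 x.2).toRingHom
  have hφ : Surjective φ := fun r ↦ ⟨MvPolynomial.C r, by simp [φ]⟩
  have hA : (powMatrix R 1 ι).map φ = A := by
    ext i j
    simp [powMatrix, φ, ι]
  rw [← hA, ← minorsIdeal_map,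
    ← subsingleton_restrictScalars_iff_of_finite _ (RingHom.Finite.of_surjective φ hφ)]
  refine ExtColimit.subsingleton_of_frobenius p (IsNoetherian.noetherian _) (d := n + 2 - m)
    (fun e ↦ ?_) (by lia) _
  rw [minorsIdeal_map, map_powMatrix_iterateFrobenius]
  exact hasProjectiveDimensionLT_quotient_minorsIdeal_powMatrix
    (pow_pos (Fact.out : p.Prime).pos e) ι hι (by lia)

theorem exists_iso_restrictScalars_of_smul_eq_zero (I : Ideal R) (M : ModuleCat.{u} R)
    (hM : ∀ r ∈ I, ∀ x : M, r • x = 0) : ∃ N : ModuleCat.{u} (R ⧸ I),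
      Nonempty ((ModuleCat.restrictScalars (Ideal.Quotient.mk I)).obj N ≅ M) := by
  have h : Module.IsTorsionBySet R M I := fun x r ↦ hM r r.2 x
  let _ := h.module
  let e : (ModuleCat.restrictScalars (Ideal.Quotient.mk I)).obj (ModuleCat.of (R ⧸ I) M) ≃ₗ[R] M :=
    { AddEquiv.refl M with map_smul' := fun r x ↦ rfl }
  exact ⟨ModuleCat.of (R ⧸ I) M, ⟨e.toModuleIso⟩⟩

theorem IsAcyclic.of_subsingleton (a : Ideal R) (M : ModuleCat.{u} R) [Subsingleton M] :
    IsAcyclic a M :=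
  have := (ModuleCat.isZero_of_subsingleton M).injective
  of_injective

theorem subsingleton_extColimit_minorsIdeal_of_prime_smul [IsNoetherianRing R] (hmn : m ≤ n)
    (A : Matrix (Fin m) (Fin n) R) {i : ℕ} (hi : n - m < i) {p : ℕ} (hp : p.Prime)
    (M : ModuleCat.{u} R) (hM : ∀ x : M, (p : R) • x = 0) :
    Subsingleton (ExtColimit (A.minorsIdeal m) (i + 1) M) := by
  by_cases hu : IsUnit (p : R)
  · have : Subsingleton M := subsingleton_of_forall_eq 0 fun x ↦ hu.smul_eq_zero.1 (hM x)
    exact IsAcyclic.of_subsingleton _ M i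
  · have : Fact p.Prime := ⟨hp⟩
    have := CharP.quotient R p hu
    obtain ⟨N, ⟨e⟩⟩ := exists_iso_restrictScalars_of_smul_eq_zero (Ideal.span {(p : R)}) M
      (fun r hr x ↦ by
        obtain ⟨c, rfl⟩ := Ideal.mem_span_singleton'.1 hr
        rw [mul_smul, hM, smul_zero])
    have : Subsingleton (ExtColimit (A.minorsIdeal m) (i + 1)
        ((ModuleCat.restrictScalars (Ideal.Quotient.mk (Ideal.span {(p : R)}))).obj N)) := by
      rw [subsingleton_restrictScalars_iff_of_finite _
        (RingHom.Finite.of_surjective _ Ideal.Quotient.mk_surjective), minorsIdeal_map]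
      exact subsingleton_extColimit_minorsIdeal_of_charP p hmn _ hi N
    exact ExtColimit.subsingleton_of_iso e

theorem subsingleton_extColimit_minorsIdeal_of_smul [IsNoetherianRing R] (hmn : m ≤ n)
    (A : Matrix (Fin m) (Fin n) R) {i : ℕ} (hi : n - m < i) {q : ℕ} (hq : 0 < q)
    (M : ModuleCat.{u} R) (hM : ∀ x : M, (q : R) • x = 0) :
    Subsingleton (ExtColimit (A.minorsIdeal m) (i + 1) M) := by
  induction q using induction_on_primes generalizing M with
  | zero => exact absurd hq (lt_irrefl 0)
  | one =>
    have : Subsingleton M := subsingleton_of_forall_eq 0 fun x ↦ by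
      rw [← one_smul R x, ← Nat.cast_one, hM]
    exact IsAcyclic.of_subsingleton _ M i
  | prime_mul p q hp ih =>
    let f := LinearMap.lsmul R M (p : R)
    let S := f.rangeRestrict.shortComplexKer
    have hS : S.ShortExact := LinearMap.shortExact_shortComplexKer f.surjective_rangeRestrict
    have h₁ : Subsingleton (ExtColimit (A.minorsIdeal m) (i + 1) S.X₁) :=
      subsingleton_extColimit_minorsIdeal_of_prime_smul hmn A hi hp _ fun x ↦ by
        have hx : (f.rangeRestrict x.1 : M) = 0 := congrArg Subtype.val (LinearMap.mem_ker.1 x.2)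
        exact Subtype.ext hx
    have h₃ : Subsingleton (ExtColimit (A.minorsIdeal m) (i + 1) S.X₃) := by
      refine ih (Nat.pos_of_mul_pos_left hq) _ ?_
      rintro ⟨_, x, rfl⟩
      apply Subtype.ext
      change (q : R) • (p : R) • x = 0
      rw [smul_smul, mul_comm, ← Nat.cast_mul, hM]
    have h₂ := ExtColimit.subsingleton_X₂ hS h₁ h₃
    exact h₂

theorem subsingleton_extColimit_minorsIdeal_min [IsNoetherianRing R] (q : ℕ) [CharP R q]
    (hq : 0 < q) (A : Matrix (Fin m) (Fin n) R) {i : ℕ} (hi : ((n : ℤ) - m).natAbs < i)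
    (M : ModuleCat.{u} R) : Subsingleton (ExtColimit (A.minorsIdeal (min m n)) (i + 1) M) := by
  have hM (x : M) : (q : R) • x = 0 := by rw [CharP.cast_eq_zero, zero_smul]
  rcases le_total m n with h | h
  · rw [min_eq_left h]
    exact subsingleton_extColimit_minorsIdeal_of_smul h A (by lia) hq M hM
  · rw [min_eq_right h, ← minorsIdeal_transpose]
    exact subsingleton_extColimit_minorsIdeal_of_smul h A.transpose (by lia) hq M hM

end UpperBound

/-! ### Artinian modules and the lower bound -/

section Artinian

theorem exists_uniform_stabilization {α : Type*} [PartialOrder α] [WellFoundedLT α]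
    {f : ℕ → ℕ → α} (hf : ∀ k, Antitone (f · k)) (hf' : ∀ j, Antitone (f j)) :
    ∃ n, ∀ j, n ≤ j → ∀ k, f n k = f j k := by
  obtain ⟨d, hd⟩ := WellFoundedLT.antitone_chain_condition (f := fun j ↦ f j j)
    fun j j' h ↦ (hf' j' h).trans (hf j h)
  have hdiag {j k : ℕ} (hj : d ≤ j) (hk : d ≤ k) : f j k = f d d := by
    refine ((hf k hj).trans (hf' d hk)).antisymm ?_
    calc f d d = f (max j k) (max j k) := hd _ (hj.trans (le_max_left j k))
      _ ≤ f (max j k) k := hf' _ (le_max_right j k)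
      _ ≤ f j k := hf k (le_max_left j k)
  choose J hJ using fun k ↦ WellFoundedLT.antitone_chain_condition (hf k)
  let n := max d ((Finset.range d).sup J)
  refine ⟨n, fun j hj k ↦ ?_⟩
  obtain hk | hk := lt_or_ge k d
  · have hn : J k ≤ n := (Finset.le_sup (Finset.mem_range.2 hk)).trans (le_max_right _ _)
    exact (hJ k n hn).symm.trans (hJ k j (hn.trans hj))
  · rw [hdiag (le_max_left _ _) hk, hdiag ((le_max_left _ _).trans hj) hk]

variable {R : Type*} [CommRing R] {H : Type*} [AddCommGroup H] [Module R H]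

/-- The leading coefficients of the elements of `N` killed by `x ^ (k + 1)`, in analogy with the
proof of Hilbert's basis theorem: the elements `x ^ k • h` with `h ∈ N` that are killed by `x`. -/
def leadingKer (x : R) (N : Submodule R H) (k : ℕ) :
    Submodule R (LinearMap.ker (LinearMap.lsmul R H x)) :=
  (N.map (LinearMap.lsmul R H (x ^ k))).comap (Submodule.subtype _)

theorem leadingKer_mono (x : R) (k : ℕ) : Monotone fun N : Submodule R H ↦ leadingKer x N k :=
  fun _ _ h ↦ Submodule.comap_mono (Submodule.map_mono h)

theorem leadingKer_antitone (x : R) (N : Submodule R H) : Antitone (leadingKer x N) := by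
  rintro k k' hk y ⟨h, hh, hy⟩
  refine ⟨x ^ (k' - k) • h, N.smul_mem _ hh, ?_⟩
  rw [← hy, LinearMap.lsmul_apply, LinearMap.lsmul_apply, smul_smul, ← pow_add,
    Nat.add_sub_cancel' hk]

theorem le_of_leadingKer_le {x : R} (htor : ∀ h : H, ∃ t : ℕ, x ^ t • h = 0) {N N' : Submodule R H}
    (hle : N' ≤ N) (h : ∀ k, leadingKer x N k ≤ leadingKer x N' k) : N ≤ N' := by
  suffices key : ∀ (t : ℕ), ∀ y ∈ N, x ^ t • y = 0 → y ∈ N' from fun y hy ↦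
    (htor y).elim fun t ↦ key t y hy
  intro t
  induction t with
  | zero =>
    intro y _ hy
    rw [pow_zero, one_smul] at hy
    exact hy ▸ N'.zero_mem
  | succ t ih =>
    intro y hyN hy
    have hker : x ^ t • y ∈ LinearMap.ker (LinearMap.lsmul R H x) := by
      rw [LinearMap.mem_ker, LinearMap.lsmul_apply, smul_smul, ← pow_succ', hy]
    obtain ⟨z, hzN, hz : x ^ t • z = x ^ t • y⟩ :=
      h t (show (⟨x ^ t • y, hker⟩ : LinearMap.ker _) ∈ leadingKer x N t from ⟨y, hyN, rfl⟩)
    have hsub : y - z ∈ N' := ih (y - z) (N.sub_mem hyN (hle hzN)) (by rw [smul_sub, hz, sub_self])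
    exact (N'.sub_mem_iff_left hzN).1 hsub

theorem isArtinian_of_isArtinian_ker_lsmul {x : R} (htor : ∀ h : H, ∃ t : ℕ, x ^ t • h = 0)
    [IsArtinian R (LinearMap.ker (LinearMap.lsmul R H x))] : IsArtinian R H := by
  refine monotone_stabilizes_iff_artinian.1 fun N ↦ ?_
  have hN : Antitone fun j ↦ OrderDual.ofDual (N j) := N.monotone
  obtain ⟨n, hn⟩ := exists_uniform_stabilization (f := fun j k ↦ leadingKer x (N j) k)
    (fun k ↦ (leadingKer_mono x k).comp_antitone hN) (fun j ↦ leadingKer_antitone x _)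
  exact ⟨n, fun j hj ↦ le_antisymm (N.monotone hj)
    (le_of_leadingKer_le htor (hN hj) fun k ↦ (hn j hj k).le)⟩

open scoped Pointwise

theorem smul_eq_self_or_exists_pow_smul_eq_bot [IsArtinian R H] {N : Submodule R H}
    (hN : SupIrred N) (x : R) : x • N = N ∨ ∃ n : ℕ, x ^ n • N = ⊥ := by
  obtain ⟨n, hcod, hn⟩ := ((LinearMap.eventually_codisjoint_ker_pow_range_pow
    (LinearMap.lsmul R N x)).and (Filter.eventually_ge_atTop 1)).exists
  have hpow : LinearMap.lsmul R N x ^ n = LinearMap.lsmul R N (x ^ n) :=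
    (map_pow (Module.toModuleEnd R N) x n).symm
  rw [hpow] at hcod
  have hsup := congrArg (Submodule.map N.subtype) hcod.eq_top
  rw [Submodule.map_sup, Submodule.map_subtype_top] at hsup
  rcases hN.2 hsup with h | h
  · right
    refine ⟨n, (Submodule.eq_bot_iff _).2 ?_⟩
    rintro _ ⟨y, hy, rfl⟩
    rw [← h] at hy
    obtain ⟨z, hz, rfl⟩ := hy
    exact congrArg Subtype.val (LinearMap.mem_ker.1 hz)
  · left
    refine le_antisymm (Submodule.smul_le_self_of_tower x N) fun y hy ↦ ?_
    rw [← h] at hy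
    obtain ⟨_, ⟨z, rfl⟩, rfl⟩ := hy
    exact ⟨x ^ (n - 1) • z, N.smul_mem _ z.2, by
      change x • x ^ (n - 1) • (z : H) = x ^ n • (z : H)
      rw [smul_smul, mul_pow_sub_one (by lia)]⟩

theorem mem_radical_annihilator_iff {N : Submodule R H} {x : R} :
    x ∈ N.annihilator.radical ↔ ∃ n : ℕ, x ^ n • N = ⊥ := by
  simp only [Ideal.mem_radical_iff, Submodule.mem_annihilator, Submodule.eq_bot_iff,
    Submodule.mem_smul_pointwise_iff_exists, forall_exists_index, and_imp,
    forall_apply_eq_imp_iff₂]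

theorem isPrime_radical_annihilator [IsArtinian R H] {N : Submodule R H} (hN : SupIrred N) :
    N.annihilator.radical.IsPrime := by
  refine (Ideal.isPrime_iff).2 ⟨fun htop ↦ hN.ne_bot ?_, fun {x y} hxy ↦ ?_⟩
  · rwa [Ideal.radical_eq_top, Submodule.annihilator_eq_top_iff] at htop
  · refine or_iff_not_imp_left.2 fun hx ↦ ?_
    have hxN : x • N = N := (smul_eq_self_or_exists_pow_smul_eq_bot hN x).resolve_right fun h ↦
      hx (mem_radical_annihilator_iff.2 h)
    have hpow (n : ℕ) : x ^ n • N = N := by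
      induction n with
      | zero => rw [pow_zero, one_smul]
      | succ n ih => rw [pow_succ, mul_smul, hxN, ih]
    obtain ⟨n, hn⟩ := mem_radical_annihilator_iff.1 hxy
    exact mem_radical_annihilator_iff.2 ⟨n, by rw [← hn, mul_comm, mul_pow, mul_smul, hpow]⟩

theorem exists_supIrred_decomposition_of_smul_top_eq_top [IsArtinian R H] {I : Ideal R}
    (hI : I.FG) (h : I • (⊤ : Submodule R H) = ⊤) : ∃ s : Finset (Submodule R H), s.sup id = ⊤ ∧
      ∀ N ∈ s, SupIrred N ∧ ¬ I ≤ N.annihilator.radical := by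
  classical
  obtain ⟨s, hs, hirr⟩ := exists_supIrred_decomposition (⊤ : Submodule R H)
  let A := {N ∈ s | ¬ I ≤ N.annihilator.radical}.sup id
  let B := {N ∈ s | I ≤ N.annihilator.radical}.sup id
  have hAB : A ⊔ B = ⊤ := by
    rw [← hs, sup_comm, ← Finset.sup_union, Finset.filter_union_filter_not_eq]
  have hB : I ≤ B.annihilator.radical := by
    refine Finset.sup_induction (p := fun N : Submodule R H ↦ I ≤ N.annihilator.radical) ?_ ?_ ?_
    · rw [Submodule.annihilator_bot, Ideal.radical_top]
      exact le_top
    · intro N hN N' hN'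
      rw [Submodule.annihilator_sup, Ideal.radical_inf]
      exact le_inf hN hN'
    · exact fun N hN ↦ (Finset.mem_filter.1 hN).2
  obtain ⟨t, ht⟩ := Ideal.exists_pow_le_of_le_radical_of_fg hB hI
  have hpow (t : ℕ) : I ^ t • (⊤ : Submodule R H) = ⊤ := by
    induction t with
    | zero => rw [pow_zero, Ideal.one_eq_top, Submodule.top_smul]
    | succ t ih => rw [pow_succ, Submodule.mul_smul, h, ih]
  refine ⟨_, top_le_iff.1 ?_, fun N hN ↦
    ⟨hirr (Finset.mem_filter.1 hN).1, (Finset.mem_filter.1 hN).2⟩⟩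
  calc ⊤ = I ^ t • A ⊔ I ^ t • B := by rw [← Submodule.smul_sup, hAB, hpow]
    _ ≤ A := sup_le Submodule.smul_le_right ((Submodule.le_annihilator_iff.1 ht).trans_le bot_le)

theorem exists_mem_smul_top_eq_top [IsArtinian R H] {I : Ideal R} (hI : I.FG)
    (h : I • (⊤ : Submodule R H) = ⊤) : ∃ x ∈ I, x • (⊤ : Submodule R H) = ⊤ := by
  obtain ⟨s, hs, hirr⟩ := exists_supIrred_decomposition_of_smul_top_eq_top hI h
  obtain ⟨x, hxI, hx⟩ : ∃ x ∈ I, ∀ N ∈ s, x ∉ N.annihilator.radical := by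
    have hnot := mt (Ideal.subset_union_prime (s := s) (f := fun N ↦ N.annihilator.radical) ⊥ ⊥
      fun N hN _ _ ↦ isPrime_radical_annihilator (hirr N hN).1).1
      fun ⟨N, hN, hle⟩ ↦ (hirr N hN).2 hle
    simpa only [Set.not_subset, Set.mem_iUnion₂, not_exists, SetLike.mem_coe] using hnot
  refine ⟨x, hxI, top_le_iff.1 (hs.ge.trans (Finset.sup_le fun N hN ↦ ?_))⟩
  have hxN : x • N = N := (smul_eq_self_or_exists_pow_smul_eq_bot (hirr N hN).1 x).resolve_right
    fun h ↦ hx N hN (mem_radical_annihilator_iff.2 h)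
  exact hxN.ge.trans (Submodule.map_mono le_top)

theorem isArtinian_of_pow_smul_eq_zero [IsNoetherianRing R] {m : Ideal R} [m.IsMaximal]
    [Module.Finite R H] {t : ℕ} (h : ∀ r ∈ m ^ t, ∀ x : H, r • x = 0) : IsArtinian R H := by
  have : Ring.KrullDimLE 0 (R ⧸ m ^ t) := Ring.krullDimLE_zero_iff.2 fun P hP ↦ by
    have hle : m ≤ P.comap (Ideal.Quotient.mk _) := Ideal.IsPrime.le_of_pow_le (n := t)
      (Ideal.mk_ker.symm.trans_le (Ideal.ker_le_comap _))
    exact Ideal.isMaximal_of_isIntegral_of_isMaximal_comap P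
      (Ideal.IsMaximal.eq_of_le ‹_› (Ideal.IsPrime.ne_top inferInstance) hle ▸ ‹m.IsMaximal›)
  have : IsArtinianRing (R ⧸ m ^ t) := IsNoetherianRing.isArtinianRing_of_krullDimLE_zero
  have hM : Module.IsTorsionBySet R H (m ^ t : Ideal R) := fun x r ↦ h r r.2 x
  let _ := hM.module
  have : Module.Finite (R ⧸ m ^ t) H := Module.Finite.of_restrictScalars_finite R (R ⧸ m ^ t) H
  exact (hM.semilinearMap.isArtinian_iff_of_bijective bijective_id).2 inferInstance

end Artinian

section Regular

variable {R : Type*} [CommRing R] [IsNoetherianRing R] {a : Ideal R}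
  {M : Type*} [AddCommGroup M] [Module R M]

variable (a M) in
theorem powTorsion_quotient_powTorsion : powTorsion a (M ⧸ powTorsion a M) = ⊥ := by
  refine eq_bot_iff.2 fun y ⟨t, ht⟩ ↦ ?_
  obtain ⟨x, rfl⟩ := Submodule.mkQ_surjective _ y
  obtain ⟨s, hs⟩ := exists_pow_smul_apply_eq_zero (a := a)
    (f := LinearMap.toSpanSingleton R M x ∘ₗ (a ^ t).subtype)
    fun w ↦ (Submodule.Quotient.mk_eq_zero _).1 (ht w w.2)
  refine (Submodule.Quotient.mk_eq_zero _).2 ⟨s + t, fun r hr ↦ ?_⟩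
  have hle : a ^ (s + t) ≤ LinearMap.ker (LinearMap.toSpanSingleton R M x) := by
    rw [pow_add]
    refine Ideal.mul_le.2 fun u hu v hv ↦ ?_
    rw [LinearMap.mem_ker, LinearMap.toSpanSingleton_apply, mul_smul]
    exact hs u hu ⟨v, hv⟩
  exact hle hr

theorem exists_mem_isSMulRegular [Module.Finite R M] (hM : powTorsion a M = ⊥) :
    ∃ x ∈ a, IsSMulRegular M x := by
  rw [← Ideal.annihilator_quotient (I := a), ← IsSMulRegular.subsingleton_linearMap_iff]
  refine subsingleton_of_forall_eq 0 fun f ↦ LinearMap.ext fun z ↦ ?_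
  have hz : f z ∈ powTorsion a M := ⟨1, fun r hr ↦ by
    rw [pow_one] at hr
    rw [← map_smul, Module.mem_annihilator.1 (Ideal.annihilator_quotient.ge hr), map_zero]⟩
  rwa [hM] at hz

end Regular

namespace ExtColimit

variable {R : Type u} [CommRing R]

theorem isArtinian_of_isSMulRegular {a : Ideal R} {i : ℕ} {x : R} (hx : x ∈ a)
    {M : ModuleCat.{u} R} (hreg : IsSMulRegular M x)
    (_ : IsArtinian R (ExtColimit a i (M.smulShortComplex x).X₃)) :
    IsArtinian R (ExtColimit a (i + 1) M) := by
  have hS : (M.smulShortComplex x).ShortExact := hreg.smulShortComplex_shortExact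
  have hsmul (z : ExtColimit a (i + 1) M) : map a (i + 1) (x • 𝟙 M) z = x • z := by
    rw [map_smul, LinearMap.smul_apply, map_id]
  have hle : LinearMap.ker (LinearMap.lsmul R (ExtColimit a (i + 1) M) x) ≤
      LinearMap.range (δ a i hS) := fun z hz ↦ (exact₁ hS z).1 ((hsmul z).trans hz)
  have hrange : IsArtinian R (LinearMap.range (δ a i hS)) :=
    isArtinian_of_surjective _ _ (δ a i hS).surjective_rangeRestrict
  have : IsArtinian R (LinearMap.ker (LinearMap.lsmul R (ExtColimit a (i + 1) M) x)) :=
    @isArtinian_of_le _ _ _ _ _ _ _ hrange hle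
  exact isArtinian_of_isArtinian_ker_lsmul fun z ↦ exists_pow_smul_eq_zero hx z

variable [IsNoetherianRing R] {m : Ideal R} [m.IsMaximal]

theorem isArtinian_zero (M : ModuleCat.{u} R) [Module.Finite R M] :
    IsArtinian R (ExtColimit m 0 M) := by
  obtain ⟨t, ht⟩ := exists_pow_smul_apply_eq_zero (f := (powTorsion m M).subtype) Subtype.prop
  have : IsArtinian R (powTorsion m M) := isArtinian_of_pow_smul_eq_zero
    fun r hr x ↦ Subtype.ext (ht r hr x)
  rw [← range_eval] at this
  exact (LinearEquiv.ofInjective _ eval_injective).isArtinian_iff.2 this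

theorem isArtinian (i : ℕ) (M : ModuleCat.{u} R) [Module.Finite R M] :
    IsArtinian R (ExtColimit m i M) := by
  induction i generalizing M with
  | zero => exact isArtinian_zero M
  | succ i ih =>
    let N := ModuleCat.of R (M ⧸ powTorsion m M)
    have : Module.Finite R N := inferInstanceAs (Module.Finite R (M ⧸ powTorsion m M))
    have hS := LinearMap.shortExact_shortComplexKer (powTorsion m M).mkQ_surjective
    have hker : powTorsion m (LinearMap.ker (powTorsion m M).mkQ) = ⊤ := by
      rw [Submodule.ker_mkQ, powTorsion_powTorsion]
    have hinj : Injective (map m (i + 1) (powTorsion m M).mkQ.shortComplexKer.g) :=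
      have := IsAcyclic.of_powTorsion_eq_top
        (M := (powTorsion m M).mkQ.shortComplexKer.X₁) hker i
      (injective_iff_map_eq_zero _).2 fun z hz ↦ by
        obtain ⟨w, rfl⟩ := (exact₂ hS z).1 hz
        rw [Subsingleton.elim w 0, map_zero]
    obtain ⟨x, hx, hreg⟩ := exists_mem_isSMulRegular (powTorsion_quotient_powTorsion m M)
    have : Module.Finite R (N.smulShortComplex x).X₃ :=
      inferInstanceAs (Module.Finite R (QuotSMulTop x N))
    have : IsArtinian R (ExtColimit m (i + 1) N) :=
      isArtinian_of_isSMulRegular hx hreg (ih (N.smulShortComplex x).X₃)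
    exact isArtinian_of_injective _ hinj

end ExtColimit

section Dimension

open IsLocalRing
open scoped Pointwise

variable {R : Type u} [CommRing R] {a : Ideal R} {i : ℕ}

variable (a i) in
/-- The local cohomology of finitely generated modules with support in `a` vanishes in
degree `i`. -/
def VanishesOnFinite : Prop :=
  ∀ (N : ModuleCat.{u} R) [Module.Finite R N], Subsingleton (ExtColimit a i N)

theorem finite_restrictScalars {T : Type u} [CommRing T] {φ : R →+* T} (hφ : φ.Finite)
    (N : ModuleCat.{u} T) [Module.Finite T N] :
    Module.Finite R ((ModuleCat.restrictScalars φ).obj N) := by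
  let _ := φ.toAlgebra
  have : Module.Finite R T := hφ
  let _ : Module R N := Module.compHom N φ
  have : IsScalarTower R T N := ⟨fun r t x ↦ mul_smul (φ r) t x⟩
  exact Module.Finite.trans (R := R) T N

namespace VanishesOnFinite

variable [IsNoetherianRing R]

theorem iSup_range_map_eq_top (h : VanishesOnFinite a (i + 1)) (N : ModuleCat.{u} R)
    [Module.Finite R N] :
    ⨆ f : ModuleCat.of R R ⟶ N, LinearMap.range (ExtColimit.map a i f) = ⊤ := by
  obtain ⟨n, p, hp⟩ := Module.Finite.exists_fin' R N
  let F := ModuleCat.of R (Fin n → R)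
  let proj (j : Fin n) : F ⟶ ModuleCat.of R R := ModuleCat.ofHom (LinearMap.proj j)
  let single (j : Fin n) : ModuleCat.of R R ⟶ F :=
    ModuleCat.ofHom (LinearMap.single R (fun _ ↦ R) j)
  have hsum : ∑ j, proj j ≫ single j = 𝟙 F := ModuleCat.hom_ext <| LinearMap.ext fun v ↦ by
    rw [ModuleCat.hom_sum, LinearMap.sum_apply]
    exact Finset.univ_sum_single v
  have : Module.Finite R p.shortComplexKer.X₁ := inferInstanceAs (Module.Finite R (LinearMap.ker p))
  have := h p.shortComplexKer.X₁
  refine eq_top_iff.2 fun z _ ↦ ?_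
  obtain ⟨y, rfl⟩ := ExtColimit.map_g_surjective (LinearMap.shortExact_shortComplexKer hp) z
  have hy : y = ∑ j, ExtColimit.map a i (single j) (ExtColimit.map a i (proj j) y) := by
    simp_rw [← ExtColimit.map_comp, ← LinearMap.sum_apply, ← map_sum, hsum, ExtColimit.map_id]
  rw [hy, map_sum]
  refine Submodule.sum_mem _ fun j _ ↦ Submodule.mem_iSup_of_mem (single j ≫ ModuleCat.ofHom p)
    ⟨ExtColimit.map a i (proj j) y, ?_⟩
  exact ExtColimit.map_comp _ _ _

theorem smul_top_eq_top (h : VanishesOnFinite a (i + 1)) (b : Ideal R)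
    [Subsingleton (ExtColimit a i (ModuleCat.of R (R ⧸ b)))] :
    b • (⊤ : Submodule R (ExtColimit a i (ModuleCat.of R R))) = ⊤ := by
  let S := b.mkQ.shortComplexKer
  have hS : S.ShortExact := LinearMap.shortExact_shortComplexKer b.mkQ_surjective
  have : Module.Finite R S.X₁ := inferInstanceAs (Module.Finite R (LinearMap.ker b.mkQ))
  have hsurj : LinearMap.range (ExtColimit.map a i S.f) = ⊤ := eq_top_iff.2 fun z _ ↦
    (ExtColimit.exact₂ hS z).1 (Subsingleton.elim (α := ExtColimit a i (.of R (R ⧸ b))) _ _)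
  rw [eq_top_iff]
  calc ⊤ = LinearMap.range (ExtColimit.map a i S.f) := hsurj.symm
    _ = ⨆ f : ModuleCat.of R R ⟶ S.X₁,
        (LinearMap.range (ExtColimit.map a i f)).map (ExtColimit.map a i S.f) := by
      rw [LinearMap.range_eq_map, ← h.iSup_range_map_eq_top, Submodule.map_iSup]
    _ ≤ b • ⊤ := iSup_le fun f ↦ ?_
  rintro _ ⟨_, ⟨z, rfl⟩, rfl⟩
  have hf : f ≫ S.f = S.f (f (1 : R)) • 𝟙 (ModuleCat.of R R) :=
    ModuleCat.hom_ext <| LinearMap.ext_ring (mul_one _).symm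
  have hmem : S.f (f (1 : R)) ∈ b := b.ker_mkQ.le (f (1 : R)).2
  rw [← ExtColimit.map_comp, hf, map_smul, LinearMap.smul_apply]
  exact Submodule.smul_mem_smul hmem trivial

theorem subsingleton_of_smul_eq_zero (h : VanishesOnFinite a (i + 1)) {x : R}
    (hx : x • (⊤ : Submodule R (ExtColimit a i (ModuleCat.of R R))) = ⊤) {N : ModuleCat.{u} R}
    [Module.Finite R N] (hN : ∀ y : N, x • y = 0) : Subsingleton (ExtColimit a i N) := by
  rw [← Submodule.subsingleton_iff R, ← subsingleton_iff_bot_eq_top, eq_comm, eq_bot_iff,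
    ← h.iSup_range_map_eq_top]
  refine iSup_le fun f ↦ ?_
  rw [LinearMap.range_eq_map, ← hx]
  rintro _ ⟨_, ⟨z, -, rfl⟩, rfl⟩
  have hf : x • f = 0 := ModuleCat.hom_ext <| LinearMap.ext fun r ↦ hN (f r)
  change ExtColimit.map a i f (x • z) = 0
  rw [map_smul, ← LinearMap.smul_apply, ← map_smul, hf, map_zero, LinearMap.zero_apply]

theorem exists_mem_quotient {m : Ideal R} [m.IsMaximal] (h : VanishesOnFinite m (i + 2)) :
    ∃ x ∈ m, VanishesOnFinite (m.map (Ideal.Quotient.mk (Ideal.span {x}))) (i + 1) := by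
  have := IsAcyclic.of_powTorsion_eq_top (M := ModuleCat.of R (R ⧸ m)) powTorsion_quotient_self i
  have : IsArtinian R (ExtColimit m (i + 1) (ModuleCat.of R R)) := by
    have : Module.Finite R (ModuleCat.of R R) := inferInstanceAs (Module.Finite R R)
    exact ExtColimit.isArtinian (i + 1) _
  obtain ⟨x, hx, hxtop⟩ := exists_mem_smul_top_eq_top (IsNoetherian.noetherian m)
    (h.smul_top_eq_top m)
  refine ⟨x, hx, fun N _ ↦ ?_⟩
  let φ := Ideal.Quotient.mk (Ideal.span {x})
  have hφ : φ.Finite := RingHom.Finite.of_surjective φ Ideal.Quotient.mk_surjective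
  let N' := (ModuleCat.restrictScalars φ).obj N
  have : Module.Finite R N' := finite_restrictScalars hφ N
  have hx0 : φ x = 0 := Ideal.Quotient.eq_zero_iff_mem.2 (Ideal.mem_span_singleton_self x)
  have hN' (y : N') : x • y = 0 :=
    (congrArg (· • (show N from y)) hx0).trans (zero_smul _ (show N from y))
  exact (subsingleton_restrictScalars_iff_of_finite m hφ i N).1
    (h.subsingleton_of_smul_eq_zero hxtop hN')

theorem isNilpotent_maximalIdeal [IsLocalRing R] (h : VanishesOnFinite (maximalIdeal R) 1) :
    IsNilpotent (maximalIdeal R) := by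
  let S := (maximalIdeal R).mkQ.shortComplexKer
  have hS : S.ShortExact := LinearMap.shortExact_shortComplexKer (maximalIdeal R).mkQ_surjective
  have : Module.Finite R S.X₁ := inferInstanceAs (Module.Finite R (LinearMap.ker _))
  have := h S.X₁
  obtain ⟨u, ⟨t, ht⟩, hu⟩ := (ExtColimit.surjective_map_zero_iff S.g).1
    (ExtColimit.map_g_surjective hS) (Ideal.Quotient.mk (maximalIdeal R) 1)
    (powTorsion_quotient_self.ge trivial)
  have hunit : IsUnit (u : R) := by
    refine notMem_maximalIdeal.1 fun hmem ↦ ?_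
    have h0 : S.g u = 0 := Ideal.Quotient.eq_zero_iff_mem.2 hmem
    exact one_ne_zero (hu.symm.trans h0)
  exact ⟨t, (Submodule.eq_bot_iff _).2 fun r hr ↦ (hunit.mul_left_eq_zero).1 (ht r hr)⟩

end VanishesOnFinite

theorem ringKrullDim_le_of_vanishesOnFinite {R : Type u} [CommRing R] [IsNoetherianRing R]
    [IsLocalRing R] {c : ℕ} (h : VanishesOnFinite (maximalIdeal R) (c + 1)) :
    ringKrullDim R ≤ c := by
  induction c generalizing R with
  | zero =>
    have : IsArtinianRing R :=
      (isArtinianRing_iff_isNilpotent_maximalIdeal R).2 h.isNilpotent_maximalIdeal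
    exact Ring.krullDimLE_iff.1 inferInstance
  | succ c ih =>
    obtain ⟨x, hx, hR⟩ := h.exists_mem_quotient
    have hne : Ideal.span {x} ≠ ⊤ := ((Ideal.span_singleton_le_iff_mem _).2 hx).trans_lt
      (maximalIdeal.isMaximal R).ne_top.lt_top |>.ne
    have : Nontrivial (R ⧸ Ideal.span {x}) := Ideal.Quotient.nontrivial_iff.2 hne
    have : IsLocalRing (R ⧸ Ideal.span {x}) :=
      IsLocalRing.of_surjective' (Ideal.Quotient.mk _) Ideal.Quotient.mk_surjective
    have hmap : (maximalIdeal R).map (Ideal.Quotient.mk (Ideal.span {x})) =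
        maximalIdeal (R ⧸ Ideal.span {x}) := eq_maximalIdeal
          (Ideal.IsMaximal.map_of_surjective_of_ker_le Ideal.Quotient.mk_surjective
            (Ideal.mk_ker.trans_le (le_maximalIdeal hne)))
    calc ringKrullDim R = (maximalIdeal R).height := maximalIdeal_height_eq_ringKrullDim.symm
      _ ≤ ringKrullDim (R ⧸ Ideal.span {x}) + 1 := Ideal.height_le_ringKrullDim_quotient_add_one hx
      _ ≤ (c + 1 : ℕ) := by
        rw [Nat.cast_succ]
        gcongr
        exact ih (hmap ▸ hR)

end Dimension

section Height

open IsLocalRing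

variable {R : Type u} [CommRing R] [IsNoetherianRing R]

theorem ringKrullDim_le_of_radical_eq_maximalIdeal [IsLocalRing R] {a : Ideal R}
    (ha : a.radical = maximalIdeal R) {c : ℕ}
    (h : ∀ N : ModuleCat.{u} R, Subsingleton (ExtColimit a (c + 1) N)) : ringKrullDim R ≤ c :=
  ringKrullDim_le_of_vanishesOnFinite fun N _ ↦ by
    have hN := ExtColimit.isZero_localCohomology_iff.2 (h N)
    have hrad : a.radical = (maximalIdeal R).radical := by
      rw [ha, (maximalIdeal.isMaximal R).isPrime.radical]
    exact ExtColimit.isZero_localCohomology_iff.1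
      (hN.of_iso ((localCohomology.isoOfSameRadical hrad (c + 1)).symm.app N))

theorem height_le_cohomologicalDimension {a : Ideal R} (ha : a ≠ ⊤) :
    a.height ≤ a.cohomologicalDimension := by
  refine le_iInf₂ fun c hc ↦ ?_
  obtain ⟨p, hp⟩ := Ideal.nonempty_minimalPrimes ha
  have : p.IsPrime := hp.1.1
  let T := Localization.AtPrime p
  have : IsNoetherianRing T := IsLocalization.isNoetherianRing p.primeCompl T inferInstance
  have hflat : (algebraMap R T).Flat :=
    RingHom.flat_algebraMap_iff.2 (IsLocalization.flat T p.primeCompl)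
  have hrad : (a.map (algebraMap R T)).radical = maximalIdeal T :=
    (IsLocalization.AtPrime.radical_map_of_mem_minimalPrimes T p a hp).trans
      (IsLocalization.AtPrime.map_eq_maximalIdeal p T)
  have hdim : ringKrullDim T ≤ c := ringKrullDim_le_of_radical_eq_maximalIdeal hrad fun N ↦
    (subsingleton_restrictScalars_iff_of_flat a hflat c N).1
      (ExtColimit.isZero_localCohomology_iff.1 (hc _ (c + 1) c.lt_succ_self))
  rw [IsLocalization.AtPrime.ringKrullDim_eq_height p T] at hdim
  exact (Ideal.height_mono hp.1.2).trans (WithBot.coe_le_coe.1 hdim)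

theorem cohomologicalDimension_minorsIdeal_le (q : ℕ) [CharP R q] (hq : 0 < q) {m n : ℕ}
    (A : Matrix (Fin m) (Fin n) R) : (A.minorsIdeal (min m n)).cohomologicalDimension ≤
      (((n : ℤ) - (m : ℤ)).natAbs + 1 : ℕ) :=
  iInf₂_le _ fun M i hi ↦ by
    obtain ⟨j, rfl⟩ := Nat.exists_eq_add_one_of_ne_zero (Nat.ne_zero_of_lt hi)
    exact ExtColimit.isZero_localCohomology_iff.2
      (subsingleton_extColimit_minorsIdeal_min q hq A (Nat.lt_of_succ_lt_succ hi) M)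

end Height

end

theorem corollary2p4 {R : Type u} [CommRing R] [IsNoetherianRing R]
    (q : ℕ) [CharP R q] (hq : 0 < q)
    (m n : ℕ) (A : Matrix (Fin m) (Fin n) R)
    (hht : (A.minorsIdeal (min m n)).height = ((((n : ℤ) - (m : ℤ)).natAbs + 1 : ℕ) : ℕ∞)) :
    (A.minorsIdeal (min m n)).cohomologicalDimension = (A.minorsIdeal (min m n)).height := by
  have hne_top : A.minorsIdeal (min m n) ≠ ⊤ := fun htop ↦
    ENat.natCast_ne_top _ (by rw [← hht, htop, Ideal.height_top])
  exact le_antisymm (hht ▸ cohomologicalDimension_minorsIdeal_le q hq A)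
    (height_le_cohomologicalDimension hne_top)
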